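/- Let $V$ be an $n$-dimensional vector space over the finite field $\mathbb{F}_q$, and let $1\le \ell\le k$ with $2k\le n$. Let $\Omega$ be the set of all subspaces of $V$ and $\Omega_j$ the set of its $j$-dimensional subspaces. If $k>\ell$, real matrices below have rows and columns indexed by $\Omega$; if $k=\ell$, then $\Omega_\ell$ is understood to be a disjoint second copy of $\Omega_k$ and the matrices are indexed by $\Omega\sqcup\Omega_\ell$. For $i,j\in\{k,\ell\}$ let $J_{i,j}$ be the $0$-$1$ matrix whose $(x,y)$ entry is $1$ if and only if $x\in\Omega_i$ and $y\in\Omega_j$; let $\overline{W}_{i,j}$ be the $0$-$1$ matrix whose $(x,y)$ entry is $1$ if and only if $x\in\Omega_i$, $y\in\Omega_j$ and $x\cap y=0$; and let $I_i$ be the diagonal $0$-$1$ matrix whose $(x,x)$ entry is $1$ if and only if $x\in\Omega_i$. Consider the semidefinite program $$\text{(D)}\quad \text{minimize } \alpha+\beta \ \text{ subject to }\ \alpha I_k+\beta I_\ell-\tfrac12\left(J_{k,\ell}+J_{\ell,k}\right)-\gamma\left(\overline{W}_{k,\ell}+\overline{W}_{\ell,k}\right)-A\succcurlyeq 0,\quad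 A\ge 0,$$ in the variables $\alpha,\beta,\gamma\in\mathbb{R}$ and $A$ a real symmetric matrix, where $\succcurlyeq 0$ means positive semidefinite and $A\ge0$ means entrywise nonnegative. Write $\binom{a}{b}_q=\prod_{i=0}^{b-1}\frac{q^{a-i}-1}{q^{b-i}-1}$ and, for $\lambda\in\mathbb{R}$, define $a(\lambda)$ and $b(\lambda)$ by $$q^{k^2}(q^k-1)\binom{n-k}{k}_q a(\lambda)=\tfrac12 q^{\ell}(q^{k-\ell}-1)\binom{n-1}{k-1}_q^{1/2}\binom{n-1}{\ell-1}_q^{1/2}+q^{\ell^2}(q^\ell-1)\binom{n-\ell}{\ell}_q\lambda,$$ $$q^{k\ell}\binom{n-k}{\ell}_q b(\lambda)=-\tfrac12 q^{\ell}\binom{n-1}{\ell}_q-q^{\ell^2}\binom{n-\ell}{\ell}_q\binom{n-1}{\ell-1}_q^{1/2}\binom{n-1}{k-1}_q^{-1/2}\lambda.$$ Then there is $\varepsilon>0$ such that for every $\lambda$ with $0<\lambda<\varepsilon$ the choice $$\alpha=\beta=\tfrac12\binom{n-1}{k-1}_q^{1/2}\binom{n-1}{\ell-1}_q^{1/2},\qquad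 \gamma=b(\lambda),\qquad A=a(\lambda)\,\overline{W}_{k,k}+\lambda\,\overline{W}_{\ell,\ell}$$ is a feasible solution to (D). -/

import Mathlib

open Module

/-- The Gaussian coefficient `∏_{i=0}^{b-1} (q^{a-i} - 1) / (q^{b-i} - 1)`, as a real number.
If `a < b`, the factor at `i = a` makes it `0`. -/
noncomputable def gauss (q : ℝ) (a b : ℕ) : ℝ :=
  ∏ i ∈ Finset.range b, (q ^ (a - i) - 1) / (q ^ (b - i) - 1)

/-- The set of `k`-dimensional subspaces of `V`. -/
def grass (K V : Type*) [Field K] [AddCommGroup V] [Module K V] (k : ℕ) : Set (Submodule K V) :=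
  {x | finrank K x = k}

/-! The matrices below are indexed by a type `ι`, each of whose members `x` names a subspace
`sub x`; the same subspace may be named by several members, which allows for a second copy of the
`ℓ`-dimensional subspaces. The sets `P`, `Q` of indices are the layers. -/

section Matrices

variable {K V ι : Type*} [Field K] [AddCommGroup V] [Module K V]

open Classical in
/-- The inclusion matrix `W` between two layers: its entry is `1` if `x ∈ P`, `y ∈ Q` and
`dim (x ∩ y) = min (dim x) (dim y)`, and `0` otherwise. -/
noncomputable def inclMatrix (sub : ι → Submodule K V) (P Q : Set ι) : Matrix ι ι ℝ :=
  Matrix.of fun x y =>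
    if x ∈ P ∧ y ∈ Q ∧
        finrank K (sub x ⊓ sub y : Submodule K V) = min (finrank K (sub x)) (finrank K (sub y))
    then 1 else 0

open Classical in
/-- The disjointness matrix `W̄` between two layers: its entry is `1` if `x ∈ P`, `y ∈ Q` and
`dim (x ∩ y) = 0`, and `0` otherwise. -/
noncomputable def disjMatrix (sub : ι → Submodule K V) (P Q : Set ι) : Matrix ι ι ℝ :=
  Matrix.of fun x y =>
    if x ∈ P ∧ y ∈ Q ∧ finrank K (sub x ⊓ sub y : Submodule K V) = 0 then 1 else 0

open Classical in
/-- The all ones block `J_{P,Q}`, with rows in `P` and columns in `Q`, and `0` elsewhere. -/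
noncomputable def onesMatrix (P Q : Set ι) : Matrix ι ι ℝ :=
  Matrix.of fun x y => if x ∈ P ∧ y ∈ Q then 1 else 0

/-- The matrix
`S = α I_P + β I_Q - (1/2) (J_{P,Q} + J_{Q,P}) - γ (W̄_{P,Q} + W̄_{Q,P}) - A`,
where `I_P = W_{P,P}`. -/
noncomputable def slackMatrix (sub : ι → Submodule K V) (P Q : Set ι)
    (α β γ : ℝ) (A : Matrix ι ι ℝ) : Matrix ι ι ℝ :=
  α • inclMatrix sub P P + β • inclMatrix sub Q Q
    - (1 / 2 : ℝ) • (onesMatrix P Q + onesMatrix Q P)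
    - γ • (disjMatrix sub P Q + disjMatrix sub Q P) - A

/-- `(α, β, γ, A)` is a feasible solution to the dual semidefinite program
"minimize `α + β` subject to `S ≽ 0` and `A ≥ 0` entrywise", in which `α β γ` are real and
`A` is a real symmetric matrix. -/
structure DualFeasible (sub : ι → Submodule K V) (P Q : Set ι)
    (α β γ : ℝ) (A : Matrix ι ι ℝ) : Prop where
  symm : A.IsSymm
  posSemidef : (slackMatrix sub P Q α β γ A).PosSemidef
  nonneg : ∀ x y, 0 ≤ A x y

end Matrices

/-- The common value of `α` and `β`. -/
noncomputable def alphaVal (q : ℝ) (n k ℓ : ℕ) : ℝ :=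
  1 / 2 * √(gauss q (n - 1) (k - 1)) * √(gauss q (n - 1) (ℓ - 1))

/-- The solution `a` of
`q^{k²} (q^k - 1) [n-k, k] a = (1/2) q^ℓ (q^{k-ℓ} - 1) [n-1, k-1]^{1/2} [n-1, ℓ-1]^{1/2}
  + q^{ℓ²} (q^ℓ - 1) [n-ℓ, ℓ] lam`. -/
noncomputable def aVal (q : ℝ) (n k ℓ : ℕ) (lam : ℝ) : ℝ :=
  (1 / 2 * q ^ ℓ * (q ^ (k - ℓ) - 1) * √(gauss q (n - 1) (k - 1)) * √(gauss q (n - 1) (ℓ - 1))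
      + q ^ (ℓ ^ 2) * (q ^ ℓ - 1) * gauss q (n - ℓ) ℓ * lam)
    / (q ^ (k ^ 2) * (q ^ k - 1) * gauss q (n - k) k)

/-- The solution `b` of
`q^{kℓ} [n-k, ℓ] b = -(1/2) q^ℓ [n-1, ℓ]
  - q^{ℓ²} [n-ℓ, ℓ] [n-1, ℓ-1]^{1/2} [n-1, k-1]^{-1/2} lam`. -/
noncomputable def bVal (q : ℝ) (n k ℓ : ℕ) (lam : ℝ) : ℝ :=
  (-(1 / 2 * q ^ ℓ * gauss q (n - 1) ℓ)
      - q ^ (ℓ ^ 2) * gauss q (n - ℓ) ℓ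
          * √(gauss q (n - 1) (ℓ - 1)) * (√(gauss q (n - 1) (k - 1)))⁻¹ * lam)
    / (q ^ (k * ℓ) * gauss q (n - k) ℓ)

/-- The one-parameter family
`α = β = (1/2) [n-1, k-1]^{1/2} [n-1, ℓ-1]^{1/2}`, `γ = b(lam)`,
`A = a(lam) W̄_{P,P} + lam W̄_{Q,Q}` is feasible at `lam`, for the layers `P` (dimension `k`)
and `Q` (dimension `ℓ`); here `q` is the order of the field and `n` the dimension of `V`. -/
def FamilyFeasible {K V ι : Type*} [Field K] [AddCommGroup V] [Module K V]
    (sub : ι → Submodule K V) (P Q : Set ι) (k ℓ : ℕ) (lam : ℝ) : Prop :=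
  DualFeasible sub P Q
    (alphaVal (Nat.card K) (finrank K V) k ℓ)
    (alphaVal (Nat.card K) (finrank K V) k ℓ)
    (bVal (Nat.card K) (finrank K V) k ℓ lam)
    (aVal (Nat.card K) (finrank K V) k ℓ lam • disjMatrix sub P P + lam • disjMatrix sub Q Q)

/-! ### Gaussian coefficients and their identities -/

section GaussianCoefficients

variable {q : ℝ}

/-! The slack matrix is block-diagonalised by harmonic functions. Every function on the
`k`-dimensional subspaces is a sum of lifts of harmonic functions of degrees `i ≤ k`
(`exists_sum_levelSum`). The disjointness matrix between the layers `k` and `ℓ` takes the lift to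
`ℓ` to θ(k,ℓ,i) times the lift to `k` (`sum_disjoint_levelSum`), where θ(k,ℓ,i) is `disjEigenvalue`.
Within one layer these scalars are distinct, so different degrees are orthogonal
(`levelSum_dotProduct_eq_zero`), and the all ones matrix sees only degree 0.

Positive semidefiniteness thus follows from conditions on small blocks (`slack_form_nonneg`): for `i
≤ ℓ` a 2×2 block with diagonal entries E_i = α - a θ(k,k,i) and F_i = α - λ θ(ℓ,ℓ,i), and for `ℓ < i
≤ k` the single entry E_i. The values of `a` and `b` are those for which the blocks of degrees 0 and
1 are singular for every λ (`block_zero`, `block_one`). Since |θ| at least halves with each degree,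
the blocks of degree at least 2 have positive determinant at λ = 0 (`block_pos_of_two_le`), and by
continuity this persists for small λ (`eventually_blocks`). The sign λ > 0 is needed only for A ≥ 0.
-/

theorem gauss_zero_right (a : ℕ) : gauss q a 0 = 1 := by simp [gauss]

theorem pow_sub_one_pos (hq : 1 < q) {a : ℕ} (ha : 0 < a) : 0 < q ^ a - 1 :=
  sub_pos.2 (one_lt_pow₀ hq ha.ne')

theorem gauss_eq_zero {a b : ℕ} (h : a < b) : gauss q a b = 0 :=
  Finset.prod_eq_zero (Finset.mem_range.2 h) (by simp)

theorem gauss_pos (hq : 1 < q) {a b : ℕ} (h : b ≤ a) : 0 < gauss q a b :=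
  Finset.prod_pos fun i hi => by
    have := Finset.mem_range.1 hi
    exact div_pos (pow_sub_one_pos hq (by omega)) (pow_sub_one_pos hq (by omega))

theorem gauss_succ_succ (a b : ℕ) :
    gauss q (a + 1) (b + 1) = gauss q a b * ((q ^ (a + 1) - 1) / (q ^ (b + 1) - 1)) := by
  simp only [gauss, Finset.prod_range_succ', Nat.add_sub_add_right, Nat.sub_zero]

/-- The `q`-factorial, up to a power of `q - 1`. -/
noncomputable def qFact (q : ℝ) (a : ℕ) : ℝ := ∏ i ∈ Finset.range a, (q ^ (i + 1) - 1)

theorem qFact_pos (hq : 1 < q) (a : ℕ) : 0 < qFact q a :=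
  Finset.prod_pos fun _ _ => pow_sub_one_pos hq (by omega)

theorem qFact_succ (a : ℕ) : qFact q (a + 1) = qFact q a * (q ^ (a + 1) - 1) :=
  Finset.prod_range_succ _ _

theorem gauss_eq_qFact_div (hq : 1 < q) (b c : ℕ) :
    gauss q (c + b) b = qFact q (c + b) / (qFact q b * qFact q c) := by
  induction b with
  | zero =>
    have := (qFact_pos hq c).ne'
    simp [gauss_zero_right, qFact] at this ⊢
    rw [div_self this]
  | succ b ih =>
    rw [← add_assoc, gauss_succ_succ, ih, qFact_succ, qFact_succ]
    have := (qFact_pos hq c).ne'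
    have := (qFact_pos hq b).ne'
    have := (pow_sub_one_pos hq (Nat.succ_pos b)).ne'
    field_simp

theorem gauss_succ_right (hq : 1 < q) (a b : ℕ) :
    gauss q a (b + 1) = gauss q a b * ((q ^ (a - b) - 1) / (q ^ (b + 1) - 1)) := by
  rcases lt_trichotomy a b with h | rfl | h
  · rw [gauss_eq_zero h, gauss_eq_zero (by omega), zero_mul]
  · rw [gauss_eq_zero (by omega)]; simp
  · obtain ⟨c, rfl⟩ : ∃ c, a = c + (b + 1) := ⟨a - (b + 1), by omega⟩
    have h2 : gauss q (c + (b + 1)) b = qFact q (c + 1 + b) / (qFact q b * qFact q (c + 1)) := by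
      rw [← gauss_eq_qFact_div hq, show c + 1 + b = c + (b + 1) by omega]
    rw [gauss_eq_qFact_div hq, h2, show c + (b + 1) - b = c + 1 by omega,
      show c + 1 + b = c + (b + 1) by omega, qFact_succ b, qFact_succ c]
    have := (qFact_pos hq c).ne'
    have := (qFact_pos hq b).ne'
    have := (pow_sub_one_pos hq (Nat.succ_pos b)).ne'
    have := (pow_sub_one_pos hq (Nat.succ_pos c)).ne'
    field_simp

theorem gauss_pascal (hq : 1 < q) (a b : ℕ) :
    gauss q (a + 1) (b + 1) = gauss q a b + q ^ (b + 1) * gauss q a (b + 1) := by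
  rcases lt_or_ge a b with h | h
  · simp [gauss_eq_zero, h, Nat.lt_succ_of_lt h]
  · rw [gauss_succ_succ, gauss_succ_right hq]
    have h1 := (pow_sub_one_pos hq (Nat.succ_pos b)).ne'
    have h2 : q ^ (a + 1) = q ^ (b + 1) * q ^ (a - b) := by rw [← pow_add]; congr 1; omega
    rw [h2]
    field_simp
    ring

theorem gauss_eq_prod_sub_pow (hq : 1 < q) (a b : ℕ) :
    gauss q a b = ∏ i ∈ Finset.range b, (q ^ a - q ^ i) / (q ^ b - q ^ i) := by
  rcases lt_or_ge a b with h | h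
  · rw [gauss_eq_zero h, Finset.prod_eq_zero (Finset.mem_range.2 h) (by simp)]
  · refine Finset.prod_congr rfl fun i hi => ?_
    have hi := Finset.mem_range.1 hi
    have h1 : q ^ a = q ^ i * q ^ (a - i) := by rw [← pow_add]; congr 1; omega
    have h2 : q ^ b = q ^ i * q ^ (b - i) := by rw [← pow_add]; congr 1; omega
    have h3 : q ^ i ≠ 0 := by positivity
    rw [h1, h2, show q ^ i * q ^ (a - i) - q ^ i = q ^ i * (q ^ (a - i) - 1) by ring,
      show q ^ i * q ^ (b - i) - q ^ i = q ^ i * (q ^ (b - i) - 1) by ring,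
      mul_div_mul_left _ _ h3]

/-- Both sides are the same `q`-multinomial coefficient; with `q` a field order, they count disjoint
pairs of subspaces up to a common power of `q`. -/
theorem gauss_mul_gauss_comm (hq : 1 < q) {n k ℓ : ℕ} (h : k + ℓ ≤ n) :
    gauss q n ℓ * gauss q (n - ℓ) k = gauss q n k * gauss q (n - k) ℓ := by
  obtain ⟨c, rfl⟩ : ∃ c, n = c + k + ℓ := ⟨n - k - ℓ, by omega⟩
  rw [show c + k + ℓ - ℓ = c + k by omega, show c + k + ℓ - k = c + ℓ by omega,
    gauss_eq_qFact_div hq, gauss_eq_qFact_div hq, gauss_eq_qFact_div hq,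
    show c + k + ℓ = c + ℓ + k by omega, gauss_eq_qFact_div hq]
  have := (qFact_pos hq c).ne'
  have := (qFact_pos hq k).ne'
  have := (qFact_pos hq ℓ).ne'
  have := (qFact_pos hq (c + k)).ne'
  have := (qFact_pos hq (c + ℓ)).ne'
  field_simp

/-- The alternating `q`-binomial sum. -/
theorem sum_neg_one_pow_mul_gauss (hq : 1 < q) (d : ℕ) :
    ∑ j ∈ Finset.range (d + 1), (-1) ^ j * q ^ (j.choose 2) * gauss q d j
      = if d = 0 then 1 else 0 := by
  rcases d with _ | d
  · simp [gauss_zero_right]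
  -- By Pascal's rule the partial sums have a closed form, whose last instance contains `gauss q d
  -- (d + 1) = 0`.
  · have key : ∀ m, ∑ j ∈ Finset.range (m + 1), (-1) ^ j * q ^ (j.choose 2) * gauss q (d + 1) j
        = (-1) ^ m * q ^ (m.choose 2) * (q ^ m * gauss q d m) := by
      intro m
      induction m with
      | zero => simp [gauss_zero_right]
      | succ m ih =>
        rw [Finset.sum_range_succ, ih, gauss_pascal hq, Nat.choose_succ_succ' m 1,
          Nat.choose_one_right, pow_add q m, pow_succ (-1 : ℝ) m]
        ring
    rw [key, gauss_eq_zero (Nat.lt_succ_self d)]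
    simp

end GaussianCoefficients

/-! ### Signs and decay of the disjointness eigenvalues -/

section DisjointnessEigenvalues

variable {q : ℝ}

/-- The scalar by which the disjointness matrix between the layers of dimensions `k` and `ℓ` acts
on the `i`-th harmonic component. -/
noncomputable def disjEigenvalue (q : ℝ) (n k ℓ i : ℕ) : ℝ :=
  (-1) ^ i * q ^ (i.choose 2) * (q ^ (k * (ℓ - i)) * gauss q (n - k - i) (ℓ - i))

theorem disjEigenvalue_zero (n k ℓ : ℕ) :
    disjEigenvalue q n k ℓ 0 = q ^ (k * ℓ) * gauss q (n - k) ℓ := by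
  simp [disjEigenvalue]

theorem disjEigenvalue_sign (hq : 1 < q) {n k ℓ i : ℕ} (hi : i ≤ ℓ) (hn : k + ℓ ≤ n) :
    0 < (-1) ^ i * disjEigenvalue q n k ℓ i := by
  have h : (-1 : ℝ) ^ i * (-1) ^ i = 1 := by rw [← mul_pow]; simp
  have hg := gauss_pos hq (a := n - k - i) (b := ℓ - i) (by omega)
  rw [disjEigenvalue, ← mul_assoc, ← mul_assoc ((-1 : ℝ) ^ i), h]
  positivity

theorem disjEigenvalue_succ (hq : 1 < q) {n k ℓ i : ℕ} (hi : i < ℓ) (hik : i ≤ k)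
    (hn : k + ℓ ≤ n) :
    disjEigenvalue q n k ℓ (i + 1) * (q ^ (k - i) * (q ^ (n - k - i) - 1))
      = -(disjEigenvalue q n k ℓ i * (q ^ (ℓ - i) - 1)) := by
  obtain ⟨m, rfl⟩ : ∃ m, ℓ = m + 1 + i := ⟨ℓ - i - 1, by omega⟩
  obtain ⟨a, rfl⟩ : ∃ a, k = a + i := ⟨k - i, by omega⟩
  obtain ⟨c, rfl⟩ : ∃ c, n = (a + i) + (c + 1 + i) := ⟨n - (a + i) - i - 1, by omega⟩
  rw [disjEigenvalue, disjEigenvalue, show m + 1 + i - i = m + 1 by omega,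
    show m + 1 + i - (i + 1) = m by omega,
    show a + i - i = a by omega, show (a + i) + (c + 1 + i) - (a + i) - i = c + 1 by omega,
    show (a + i) + (c + 1 + i) - (a + i) - (i + 1) = c by omega,
    gauss_succ_succ, Nat.choose_succ_succ' i 1, Nat.choose_one_right, pow_add q i,
    pow_succ (-1 : ℝ) i]
  have h1 := (pow_sub_one_pos hq (Nat.succ_pos m)).ne'
  field_simp
  ring

/-- The ratio of consecutive absolute values is (q^(ℓ-i) - 1) / (q^(k-i) (q^(n-k-i) - 1)). Here ℓ -
i ≤ n - k - i, and q^(k-i) ≥ 2 because `i < k`. -/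
theorem abs_disjEigenvalue_succ_le (hq : 2 ≤ q) {n k ℓ i : ℕ} (hi : i < ℓ) (hik : i < k)
    (hn : k + ℓ ≤ n) :
    |disjEigenvalue q n k ℓ (i + 1)| ≤ 1 / 2 * |disjEigenvalue q n k ℓ i| := by
  have hq1 : 1 < q := by linarith
  have h := congrArg abs (disjEigenvalue_succ hq1 hi hik.le hn)
  have h1 := pow_sub_one_pos hq1 (a := n - k - i) (by omega)
  have h2 := pow_sub_one_pos hq1 (a := ℓ - i) (by omega)
  have h3 : q ^ (ℓ - i) - 1 ≤ q ^ (n - k - i) - 1 :=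
    sub_le_sub_right (pow_le_pow_right₀ hq1.le (by omega)) _
  have h4 : 2 ≤ q ^ (k - i) := hq.trans (le_self_pow₀ hq1.le (by omega))
  rw [abs_neg, abs_mul, abs_mul, abs_mul, abs_of_pos h1, abs_of_pos h2,
    abs_of_pos (by positivity : 0 < q ^ (k - i))] at h
  have h5 : |disjEigenvalue q n k ℓ (i + 1)| * (2 * (q ^ (n - k - i) - 1))
      ≤ |disjEigenvalue q n k ℓ i| * (q ^ (n - k - i) - 1) := by
    calc _ ≤ |disjEigenvalue q n k ℓ (i + 1)| * (q ^ (k - i) * (q ^ (n - k - i) - 1)) := by gcongr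
      _ = _ := h
      _ ≤ _ := by gcongr
  have h6 : (|disjEigenvalue q n k ℓ (i + 1)| * 2) * (q ^ (n - k - i) - 1)
      ≤ |disjEigenvalue q n k ℓ i| * (q ^ (n - k - i) - 1) := by linarith
  linarith [le_of_mul_le_mul_right h6 h1]

theorem abs_disjEigenvalue_le (hq : 2 ≤ q) {n k ℓ i j : ℕ} (hij : i < j) (hj : j ≤ ℓ)
    (hjk : j ≤ k) (hn : k + ℓ ≤ n) :
    |disjEigenvalue q n k ℓ j| ≤ 1 / 2 * |disjEigenvalue q n k ℓ i| := by
  induction j, hij using Nat.le_induction with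
  | base => exact abs_disjEigenvalue_succ_le hq hj hjk hn
  | succ j hij ih =>
    have := abs_disjEigenvalue_succ_le hq (n := n) (k := k) (ℓ := ℓ) (i := j) hj hjk hn
    have := ih (by omega) (by omega)
    have := abs_nonneg (disjEigenvalue q n k ℓ j)
    linarith

theorem disjEigenvalue_ne_zero (hq : 1 < q) {n k ℓ i : ℕ} (hi : i ≤ ℓ) (hn : k + ℓ ≤ n) :
    disjEigenvalue q n k ℓ i ≠ 0 :=
  fun h => by simpa [h] using disjEigenvalue_sign hq hi hn

/-- The absolute values are nonzero and strictly decreasing. Distinctness is what makes harmonic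
components orthogonal. -/
theorem disjEigenvalue_injOn (hq : 2 ≤ q) {n k i j : ℕ} (hi : i ≤ k) (hj : j ≤ k) (hij : i ≠ j)
    (hn : 2 * k ≤ n) : disjEigenvalue q n k k i ≠ disjEigenvalue q n k k j := by
  wlog h : i < j generalizing i j
  · exact (this hj hi hij.symm (by omega)).symm
  intro he
  have h1 := abs_disjEigenvalue_le hq h hj hj (by omega : k + k ≤ n)
  have h2 := abs_pos.2 (disjEigenvalue_ne_zero (q := q) (by linarith) hj (by omega : k + k ≤ n))
  rw [he] at h1
  linarith

end DisjointnessEigenvalues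

/-! ### Counting subspaces by means of independent tuples -/

section Counting

variable {K V : Type*} [Field K] [AddCommGroup V] [Module K V]

theorem linearIndependent_mkQ_comp_iff {ι : Type*} (w : Submodule K V) (t : ι → V) :
    LinearIndependent K (w.mkQ ∘ t) ↔
      LinearIndependent K t ∧ Disjoint (Submodule.span K (Set.range t)) w := by
  constructor
  · intro h
    refine ⟨h.of_comp, ?_⟩
    simpa using Submodule.range_ker_disjoint h
  · rintro ⟨h1, h2⟩
    exact h1.map (by simpa using h2)

variable [Finite K] [FiniteDimensional K V]

theorem natCard_linearIndependent (m : ℕ) :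
    (Nat.card {s : Fin m → V // LinearIndependent K s} : ℝ)
      = ∏ i ∈ Finset.range m, ((Nat.card K : ℝ) ^ finrank K V - (Nat.card K : ℝ) ^ i) := by
  have : Fintype K := Fintype.ofFinite K
  have : Finite V := Module.finite_of_finite K
  rcases le_or_gt m (finrank K V) with h | h
  · rw [card_linearIndependent h, Nat.cast_prod, Finset.prod_range, Nat.card_eq_fintype_card]
    refine Finset.prod_congr rfl fun i _ => ?_
    rw [Nat.cast_sub (Nat.pow_le_pow_right Fintype.card_pos (by omega))]
    push_cast
    rfl
  -- With more vectors than the dimension, the factor at `i = finrank K V` vanishes, as does the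
  -- count.
  · rw [Finset.prod_eq_zero (Finset.mem_range.2 h) (sub_self _)]
    have : IsEmpty {s : Fin m → V // LinearIndependent K s} :=
      ⟨fun s => by simpa using h.trans_le ((Fintype.card_fin m).symm.le.trans s.2.fintype_card_le_finrank)⟩
    simp

theorem natCard_linearIndependent_disjoint (w : Submodule K V) (m : ℕ) :
    (Nat.card {t : Fin m → V //
        LinearIndependent K t ∧ Disjoint (Submodule.span K (Set.range t)) w} : ℝ)
      = ((Nat.card K : ℝ) ^ finrank K w) ^ m * ∏ i ∈ Finset.range m,
          ((Nat.card K : ℝ) ^ (finrank K V - finrank K w) - (Nat.card K : ℝ) ^ i) := by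
  -- Choosing representatives of the cosets splits a tuple into an independent tuple of `V ⧸ w` and
  -- arbitrary components in `w`.
  let e : {t : Fin m → V // LinearIndependent K t ∧
      Disjoint (Submodule.span K (Set.range t)) w} ≃
      (Fin m → w) × {s : Fin m → V ⧸ w // LinearIndependent K s} :=
    { toFun := fun t => (fun j => ⟨t.1 j - (w.mkQ (t.1 j)).out, by
          rw [← Submodule.Quotient.mk_eq_zero, Submodule.Quotient.mk_sub]
          simp [Submodule.Quotient.mk_out]⟩,
        ⟨w.mkQ ∘ t.1, (linearIndependent_mkQ_comp_iff w _).2 t.2⟩)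
      invFun := fun p => ⟨fun j => (p.1 j : V) + (p.2.1 j).out, by
          rw [← linearIndependent_mkQ_comp_iff]
          convert p.2.2 using 1
          funext j
          simp [Submodule.Quotient.mk_out]⟩
      left_inv := fun t => by ext j; simp
      right_inv := fun p => by
        have h : ∀ j, w.mkQ ((p.1 j : V) + (p.2.1 j).out) = p.2.1 j := fun j => by
          simp [Submodule.Quotient.mk_out]
        ext j
        · simp only [h]; simp
        · exact h j }
  rw [Nat.card_congr e, Nat.card_prod, Nat.cast_mul, natCard_linearIndependent,
    Submodule.finrank_quotient, Nat.card_fun, Nat.card_fin, natCard_eq_pow_finrank (K := K)]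
  push_cast
  rfl

theorem natCard_linearIndependent_disjoint_mem (z y : Submodule K V) (hy : y ≤ z) (m : ℕ) :
    (Nat.card {t : Fin m → V // (∀ j, t j ∈ z) ∧
        LinearIndependent K t ∧ Disjoint (Submodule.span K (Set.range t)) y} : ℝ)
      = ((Nat.card K : ℝ) ^ finrank K y) ^ m * ∏ i ∈ Finset.range m,
          ((Nat.card K : ℝ) ^ (finrank K z - finrank K y) - (Nat.card K : ℝ) ^ i) := by
  have key : ∀ t : Fin m → z, (LinearIndependent K (fun j => (t j : V)) ∧
      Disjoint (Submodule.span K (Set.range fun j => (t j : V))) y) ↔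
      (LinearIndependent K t ∧ Disjoint (Submodule.span K (Set.range t)) (y.comap z.subtype)) := by
    intro t
    have h1 : (fun j => (t j : V)) = z.subtype ∘ t := rfl
    have h2 : Submodule.span K (Set.range fun j => (t j : V))
        = (Submodule.span K (Set.range t)).map z.subtype := by
      rw [h1, Set.range_comp, Submodule.map_span]
    rw [h2, h1, LinearMap.linearIndependent_iff _ (Submodule.ker_subtype z)]
    refine and_congr_right fun _ => ?_
    rw [Submodule.disjoint_def, Submodule.disjoint_def]
    constructor
    · intro h x hx hxy
      exact Subtype.ext (h x (Submodule.mem_map_of_mem hx) hxy)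
    · rintro h _ ⟨x, hx, rfl⟩ hxy
      simp [h x hx hxy]
  let e : {t : Fin m → V // (∀ j, t j ∈ z) ∧
      LinearIndependent K t ∧ Disjoint (Submodule.span K (Set.range t)) y} ≃
      {t : Fin m → z // LinearIndependent K t ∧
        Disjoint (Submodule.span K (Set.range t)) (y.comap z.subtype)} :=
    { toFun := fun t => ⟨fun j => ⟨t.1 j, t.2.1 j⟩, (key _).1 t.2.2⟩
      invFun := fun t => ⟨fun j => (t.1 j : V), fun j => (t.1 j).2, (key _).2 t.2⟩
      left_inv := fun t => rfl
      right_inv := fun t => rfl }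
  rw [Nat.card_congr e, natCard_linearIndependent_disjoint,
    (Submodule.comapSubtypeEquivOfLe hy).finrank_eq]

/-- The number of subspaces which meet `w` exactly in `y` and have dimension `dim y + m`. -/
theorem natCard_inf_eq (y w : Submodule K V) (hy : y ≤ w) (m : ℕ) :
    (Nat.card {z : Submodule K V // z ⊓ w = y ∧ finrank K z = finrank K y + m} : ℝ)
      = (Nat.card K : ℝ) ^ ((finrank K w - finrank K y) * m)
        * gauss (Nat.card K) (finrank K V - finrank K w) m := by
  have : Finite V := Module.finite_of_finite K
  have hq : (1 : ℝ) < Nat.card K := by exact_mod_cast Finite.one_lt_card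
  have sup_finrank : ∀ t : Fin m → V, LinearIndependent K t →
      Disjoint (Submodule.span K (Set.range t)) y →
      finrank K (y ⊔ Submodule.span K (Set.range t) : Submodule K V) = finrank K y + m := by
    intro t ht hd
    have := Submodule.finrank_sup_add_finrank_inf_eq y (Submodule.span K (Set.range t))
    rw [hd.symm.eq_bot, finrank_bot, finrank_span_eq_card ht, Fintype.card_fin] at this
    exact this
  -- Double counting: each tuple `t` independent modulo `w` is sorted by the subspace `y ⊔ span t`.
  -- All fibres have the same size, as they consist of the tuples of `z` independent modulo `y`.
  let e : {t : Fin m → V // LinearIndependent K t ∧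
        Disjoint (Submodule.span K (Set.range t)) w} ≃
      Σ z : {z : Submodule K V // z ⊓ w = y ∧ finrank K z = finrank K y + m},
        {t : Fin m → V // (∀ j, t j ∈ z.1) ∧
          LinearIndependent K t ∧ Disjoint (Submodule.span K (Set.range t)) y} :=
    { toFun := fun t => ⟨⟨y ⊔ Submodule.span K (Set.range t.1), by
          rw [sup_inf_assoc_of_le _ hy, t.2.2.eq_bot, sup_bot_eq],
          sup_finrank t.1 t.2.1 (t.2.2.mono_right hy)⟩,
        ⟨t.1, fun j => Submodule.mem_sup_right (Submodule.subset_span ⟨j, rfl⟩), t.2.1,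
          t.2.2.mono_right hy⟩⟩
      invFun := fun p => ⟨p.2.1, p.2.2.2.1, by
          have hz : Submodule.span K (Set.range p.2.1) ≤ p.1.1 :=
            Submodule.span_le.2 (by rintro _ ⟨j, rfl⟩; exact p.2.2.1 j)
          rw [disjoint_iff_inf_le, ← p.2.2.2.2.eq_bot]
          exact le_inf inf_le_left ((inf_le_inf_right w hz).trans p.1.2.1.le)⟩
      left_inv := fun t => rfl
      right_inv := by
        rintro ⟨⟨z, hz, hzd⟩, t, ht, hti, htd⟩
        have hle : y ⊔ Submodule.span K (Set.range t) ≤ z :=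
          sup_le (hz ▸ inf_le_left) (Submodule.span_le.2 (by rintro _ ⟨j, rfl⟩; exact ht j))
        have := Submodule.eq_of_le_of_finrank_eq hle ((sup_finrank t hti htd).trans hzd.symm)
        subst this
        rfl }
  have hcard := congrArg (Nat.cast : ℕ → ℝ) (Nat.card_congr e)
  have : Fintype {z : Submodule K V // z ⊓ w = y ∧ finrank K z = finrank K y + m} :=
    Fintype.ofFinite _
  rw [natCard_linearIndependent_disjoint, Nat.card_sigma, Nat.cast_sum,
    Finset.sum_congr rfl (fun z _ => natCard_linearIndependent_disjoint_mem z.1 y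
      (z.2.1.symm.le.trans inf_le_left) m),
    Finset.sum_congr rfl (fun z _ => by rw [z.2.2, Nat.add_sub_cancel_left]),
    Finset.sum_const, Finset.card_univ, nsmul_eq_mul] at hcard
  have hpos : 0 < ∏ i ∈ Finset.range m, ((Nat.card K : ℝ) ^ m - (Nat.card K : ℝ) ^ i) :=
    Finset.prod_pos fun i hi => sub_pos.2 (pow_lt_pow_right₀ hq (Finset.mem_range.1 hi))
  have hle := Submodule.finrank_mono hy
  have hpow : ((Nat.card K : ℝ) ^ finrank K w) ^ m
      = (Nat.card K : ℝ) ^ ((finrank K w - finrank K y) * m)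
        * ((Nat.card K : ℝ) ^ finrank K y) ^ m := by
    rw [pow_mul, ← mul_pow, ← pow_add, Nat.sub_add_cancel hle]
  rw [gauss_eq_prod_sub_pow hq, Finset.prod_div_distrib, Nat.card_eq_fintype_card]
  have hq0 : (Nat.card K : ℝ) ≠ 0 := by positivity
  rw [hpow] at hcard
  field_simp
  field_simp at hcard
  linarith

theorem natCard_finrank_eq (m : ℕ) :
    (Nat.card {z : Submodule K V // finrank K z = m} : ℝ)
      = gauss (Nat.card K) (finrank K V) m := by
  simpa using natCard_inf_eq (⊥ : Submodule K V) ⊥ le_rfl m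

/-- The number of `j`-dimensional subspaces between `u` and `x`. -/
theorem natCard_between (u x : Submodule K V) (hu : u ≤ x) (j : ℕ) (hj : finrank K u ≤ j) :
    (Nat.card {y : Submodule K V // u ≤ y ∧ y ≤ x ∧ finrank K y = j} : ℝ)
      = gauss (Nat.card K) (finrank K x - finrank K u) (j - finrank K u) := by
  -- Inside `x`, with `y = w = u`, the condition `z ⊓ u = u` just says `u ≤ z`, and the power of `q`
  -- is trivial.
  have h := natCard_inf_eq (u.comap x.subtype) (u.comap x.subtype) le_rfl (j - finrank K u)
  have hf := (Submodule.comapSubtypeEquivOfLe hu).finrank_eq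
  rw [Nat.sub_self, zero_mul, pow_zero, one_mul, hf] at h
  rw [← h]
  congr 1
  refine Nat.card_congr
    { toFun := fun y => ⟨y.1.comap x.subtype, by
        rw [inf_eq_right]
        exact Submodule.comap_mono y.2.1, by
        rw [(Submodule.comapSubtypeEquivOfLe y.2.2.1).finrank_eq, y.2.2.2]; omega⟩
      invFun := fun z => ⟨z.1.map x.subtype, by
        have := Submodule.map_mono (f := x.subtype) (inf_eq_right.1 z.2.1)
        rwa [Submodule.map_comap_subtype, inf_eq_right.2 hu] at this,
        Submodule.map_subtype_le _ _, by
        rw [Submodule.finrank_map_subtype_eq, z.2.2]; omega⟩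
      left_inv := fun y => Subtype.ext (by
        simp [Submodule.map_comap_subtype, inf_eq_right.2 y.2.2.1])
      right_inv := fun z => Subtype.ext (by
        exact Submodule.comap_map_eq_of_injective x.injective_subtype _) }

end Counting

/-! ### Harmonic functions, their lifts and the action of the disjointness matrix -/

section Harmonic

open scoped Classical
open scoped Matrix

variable {K V : Type*} [Field K] [AddCommGroup V] [Module K V] [Fintype (Submodule K V)]

/-- The lift of a function on subspaces to the `k`-dimensional subspaces: the value at `x` is the
sum of the values at all subspaces of `x`. -/
noncomputable def levelSum (k : ℕ) : (Submodule K V → ℝ) →ₗ[ℝ] (Submodule K V → ℝ) where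
  toFun h x := if finrank K x = k then ∑ y with y ≤ x, h y else 0
  map_add' h h' := by
    funext x
    by_cases hx : finrank K x = k <;> simp [hx, Finset.sum_add_distrib]
  map_smul' c h := by
    funext x
    by_cases hx : finrank K x = k <;> simp [hx, Finset.mul_sum]

theorem levelSum_apply (k : ℕ) (h : Submodule K V → ℝ) (x : Submodule K V) :
    levelSum k h x = if finrank K x = k then ∑ y with y ≤ x, h y else 0 := rfl

theorem levelSum_eq_zero (k : ℕ) (h : Submodule K V → ℝ) (x : Submodule K V)
    (hx : finrank K x ≠ k) : levelSum k h x = 0 := if_neg hx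

/-- The functions supported in dimension `i` whose sum over the subspaces containing `u` vanishes
whenever `dim u < i`. -/
def harmonicFun (K V : Type*) [Field K] [AddCommGroup V] [Module K V] [Fintype (Submodule K V)]
    (i : ℕ) : Submodule ℝ (Submodule K V → ℝ) where
  carrier := {h | (∀ x : Submodule K V, finrank K x ≠ i → h x = 0) ∧
    ∀ u : Submodule K V, finrank K u < i → ∑ y with u ≤ y, h y = 0}
  add_mem' {h h'} hh hh' := by
    refine ⟨fun x hx => by simp [hh.1 x hx, hh'.1 x hx], fun u hu => ?_⟩
    simp [Finset.sum_add_distrib, hh.2 u hu, hh'.2 u hu]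
  zero_mem' := by simp
  smul_mem' c h hh := by
    refine ⟨fun x hx => by simp [hh.1 x hx], fun u hu => ?_⟩
    simp [← Finset.mul_sum, hh.2 u hu]

/-- Its lifts are the constant functions on the layers, so orthogonality to it computes sums over a
layer. -/
theorem single_bot_mem_harmonic [FiniteDimensional K V] :
    (fun x => if x = ⊥ then 1 else 0) ∈ harmonicFun K V 0 := by
  refine ⟨fun x hx => ?_, fun u hu => absurd hu (Nat.not_lt_zero _)⟩
  refine if_neg ?_
  rintro rfl
  simp at hx

/-- The disjointness matrix on the set of all subspaces. -/
noncomputable def fullDisj (K V : Type*) [Field K] [AddCommGroup V] [Module K V] :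
    Matrix (Submodule K V) (Submodule K V) ℝ :=
  Matrix.of fun u v => if u ⊓ v = ⊥ then 1 else 0

/-- The all ones matrix on the set of all subspaces. -/
def fullOnes (K V : Type*) [Field K] [AddCommGroup V] [Module K V] :
    Matrix (Submodule K V) (Submodule K V) ℝ :=
  Matrix.of fun _ _ => 1

theorem dotProduct_fullDisj_comm (f g : Submodule K V → ℝ) :
    f ⬝ᵥ fullDisj K V *ᵥ g = g ⬝ᵥ fullDisj K V *ᵥ f := by
  have h : (fullDisj K V)ᵀ = fullDisj K V := by
    ext u v
    simp [fullDisj, inf_comm]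
  rw [Matrix.dotProduct_mulVec, ← Matrix.mulVec_transpose, h, dotProduct_comm]

variable [FiniteDimensional K V]

/-- Below dimension `i` the sum vanishes by harmonicity, in dimension `i` only `y = u` contributes,
and above it the support of `h` is missed. -/
theorem moebius_mul_sum_of_mem_harmonic {i : ℕ} {h : Submodule K V → ℝ}
    (hh : h ∈ harmonicFun K V i) (u : Submodule K V) :
    (-1 : ℝ) ^ finrank K u * (Nat.card K : ℝ) ^ ((finrank K u).choose 2) * ∑ y with u ≤ y, h y
      = (-1 : ℝ) ^ i * (Nat.card K : ℝ) ^ (i.choose 2) * h u := by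
  rcases lt_trichotomy (finrank K u) i with hu | hu | hu
  · rw [hh.2 u hu, hh.1 u hu.ne, mul_zero, mul_zero]
  · rw [hu, Finset.sum_eq_single u]
    · intro y hy hyu
      refine hh.1 y fun hyi => hyu ?_
      exact (Submodule.eq_of_le_of_finrank_eq (Finset.mem_filter.1 hy).2 (hu.trans hyi.symm)).symm
    · simp
  · rw [hh.1 u hu.ne', Finset.sum_eq_zero, mul_zero, mul_zero]
    intro y hy
    exact hh.1 y (hu.trans_le (Submodule.finrank_mono (Finset.mem_filter.1 hy).2)).ne'

theorem levelSum_of_mem_harmonic_zero {k : ℕ} {h : Submodule K V → ℝ} (hh : h ∈ harmonicFun K V 0)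
    (x : Submodule K V) : levelSum k h x = if finrank K x = k then h ⊥ else 0 := by
  rw [levelSum_apply]
  congr 1
  refine Finset.sum_eq_single ⊥ (fun y _ hy => hh.1 y ?_) (by simp)
  rwa [Ne, Submodule.finrank_eq_zero]

variable [Finite K]

theorem natCard_between_eq_card (u x : Submodule K V) (hu : u ≤ x) (j : ℕ)
    (hj : finrank K u ≤ j) :
    ((Finset.univ.filter fun y : Submodule K V => u ≤ y ∧ y ≤ x ∧ finrank K y = j).card : ℝ)
      = gauss (Nat.card K) (finrank K x - finrank K u) (j - finrank K u) := by
  rw [← natCard_between u x hu j hj, Nat.card_eq_fintype_card, Fintype.card_subtype]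

/-- Inversion over the lattice of subspaces. -/
theorem sum_moebius (x : Submodule K V) :
    ∑ u with u ≤ x, (-1 : ℝ) ^ finrank K u * (Nat.card K : ℝ) ^ ((finrank K u).choose 2)
      = if x = ⊥ then 1 else 0 := by
  have hq : (1 : ℝ) < Nat.card K := by exact_mod_cast Finite.one_lt_card
  rw [← Finset.sum_fiberwise_of_maps_to (g := fun u : Submodule K V => finrank K u)
    (t := Finset.range (finrank K x + 1))
    (fun u hu => Finset.mem_range.2 (Nat.lt_succ_of_le
      (Submodule.finrank_mono (Finset.mem_filter.1 hu).2)))]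
  have h := sum_neg_one_pow_mul_gauss hq (finrank K x)
  simp only [Submodule.finrank_eq_zero] at h
  rw [← h]
  refine Finset.sum_congr rfl fun j _ => ?_
  have hc := natCard_between_eq_card ⊥ x bot_le j (by simp)
  simp only [finrank_bot, Nat.sub_zero, bot_le, true_and] at hc
  rw [← hc, Finset.filter_filter, Finset.sum_congr rfl (fun u hu => by
    rw [(Finset.mem_filter.1 hu).2.2]), Finset.sum_const, nsmul_eq_mul, mul_comm]

/-- Möbius inversion writes the indicator of `x ⊓ y = ⊥` as a sum over `u ≤ x ⊓ y`. After
interchanging sums, harmonicity collapses the inner sum to a multiple of `h u`. -/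
theorem sum_disjoint_of_mem_harmonic {i : ℕ} {h : Submodule K V → ℝ} (hh : h ∈ harmonicFun K V i)
    (x : Submodule K V) :
    ∑ y with x ⊓ y = ⊥, h y
      = (-1 : ℝ) ^ i * (Nat.card K : ℝ) ^ (i.choose 2) * ∑ y with y ≤ x, h y := by
  have h1 : ∀ y, (if x ⊓ y = ⊥ then h y else 0) = ∑ u : Submodule K V,
      if u ≤ x then if u ≤ y then (-1 : ℝ) ^ finrank K u *
        (Nat.card K : ℝ) ^ ((finrank K u).choose 2) * h y else 0 else 0 := by
    intro y
    have := congrArg (· * h y) (sum_moebius (x ⊓ y))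
    simp only [ite_mul, one_mul, zero_mul] at this
    rw [← this, Finset.sum_filter, Finset.sum_mul]
    refine Finset.sum_congr rfl fun u _ => ?_
    by_cases hx : u ≤ x <;> by_cases hy : u ≤ y <;> simp [hx, hy]
  rw [Finset.sum_filter, Finset.sum_congr rfl fun y _ => h1 y, Finset.sum_comm,
    Finset.sum_filter, Finset.mul_sum]
  refine Finset.sum_congr rfl fun u _ => ?_
  by_cases hx : u ≤ x
  · simp only [hx, if_true]
    rw [← moebius_mul_sum_of_mem_harmonic hh u, ← Finset.sum_filter, Finset.mul_sum]
  · simp [hx]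

/-- By the modular law and `x ⊓ y = ⊥`, a subspace `z ≥ y` is disjoint from `x` exactly when `z ⊓ (x
⊔ y) = y`. -/
theorem card_le_disjoint (x y : Submodule K V) (hxy : x ⊓ y = ⊥) {ℓ : ℕ} (hy : finrank K y ≤ ℓ) :
    ((Finset.univ.filter fun z : Submodule K V =>
        y ≤ z ∧ x ⊓ z = ⊥ ∧ finrank K z = ℓ).card : ℝ)
      = (Nat.card K : ℝ) ^ (finrank K x * (ℓ - finrank K y))
        * gauss (Nat.card K) (finrank K V - finrank K x - finrank K y) (ℓ - finrank K y) := by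
  have hf := Submodule.finrank_sup_add_finrank_inf_eq x y
  rw [hxy, finrank_bot, add_zero] at hf
  have h := natCard_inf_eq y (x ⊔ y) le_sup_right (ℓ - finrank K y)
  rw [hf, Nat.add_sub_cancel, ← Nat.sub_sub] at h
  rw [← h, Nat.card_eq_fintype_card, Fintype.card_subtype]
  congr 2
  ext z
  simp only [Finset.mem_filter, Finset.mem_univ, true_and]
  rw [Nat.add_sub_cancel' hy]
  constructor
  · rintro ⟨h1, h2, h3⟩
    refine ⟨?_, h3⟩
    rw [sup_comm, inf_comm, sup_inf_assoc_of_le _ h1, h2, sup_bot_eq]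
  · rintro ⟨h1, h3⟩
    have hyz : y ≤ z := h1.symm.le.trans inf_le_left
    refine ⟨hyz, ?_, h3⟩
    rw [eq_bot_iff, ← hxy]
    exact le_inf inf_le_left ((le_inf inf_le_right (inf_le_left.trans le_sup_left)).trans h1.le)

/-- Interchanging sums leaves, for each `y` of dimension `i` disjoint from `x`, the number of `z ≥
y` disjoint from `x`. It does not depend on `y`, so the unlifted identity applies. -/
theorem sum_disjoint_levelSum {i k ℓ : ℕ} (hi : i ≤ ℓ) {h : Submodule K V → ℝ}
    (hh : h ∈ harmonicFun K V i) (x : Submodule K V) (hx : finrank K x = k) :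
    ∑ z with x ⊓ z = ⊥, levelSum ℓ h z
      = disjEigenvalue (Nat.card K) (finrank K V) k ℓ i * levelSum k h x := by
  have h1 : ∑ z with x ⊓ z = ⊥, levelSum ℓ h z = ∑ y with x ⊓ y = ⊥,
      (Nat.card K : ℝ) ^ (k * (ℓ - i))
        * gauss (Nat.card K) (finrank K V - k - i) (ℓ - i) * h y := by
    calc ∑ z with x ⊓ z = ⊥, levelSum ℓ h z
        = ∑ z with x ⊓ z = ⊥ ∧ finrank K z = ℓ, ∑ y with y ≤ z, h y := by
          rw [← Finset.filter_filter, Finset.sum_filter _ _ (s := Finset.filter _ _)]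
          rfl
      _ = ∑ y, ∑ z with y ≤ z ∧ x ⊓ z = ⊥ ∧ finrank K z = ℓ, h y :=
          Finset.sum_comm' fun z y => by simp; tauto
      _ = _ := by
          rw [Finset.sum_filter]
          refine Finset.sum_congr rfl fun y _ => ?_
          rw [Finset.sum_const, nsmul_eq_mul]
          split_ifs with hxy
          · by_cases hy : finrank K y = i
            · rw [card_le_disjoint x y hxy (hy.trans_le hi), hx, hy]
            · simp [hh.1 y hy]
          · rw [Finset.card_eq_zero.2, Nat.cast_zero, zero_mul]
            refine Finset.filter_eq_empty_iff.2 fun z _ hz => hxy ?_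
            rw [eq_bot_iff, ← hz.2.1]
            exact inf_le_inf_left x hz.1
  rw [h1, ← Finset.mul_sum, sum_disjoint_of_mem_harmonic hh, levelSum_apply, if_pos hx,
    disjEigenvalue]
  ring

theorem dotProduct_fullDisj_levelSum {i k ℓ : ℕ} (hi : i ≤ ℓ) {h : Submodule K V → ℝ}
    (hh : h ∈ harmonicFun K V i) {f : Submodule K V → ℝ} (hf : ∀ x : Submodule K V, finrank K x ≠ k → f x = 0) :
    f ⬝ᵥ fullDisj K V *ᵥ levelSum ℓ h
      = disjEigenvalue (Nat.card K) (finrank K V) k ℓ i * (f ⬝ᵥ levelSum k h) := by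
  simp only [dotProduct, Finset.mul_sum]
  refine Finset.sum_congr rfl fun x _ => ?_
  by_cases hx : finrank K x = k
  · have : (fullDisj K V *ᵥ levelSum ℓ h) x = ∑ z with x ⊓ z = ⊥, levelSum ℓ h z := by
      simp [Matrix.mulVec, dotProduct, fullDisj, Finset.sum_filter]
    rw [this, sum_disjoint_levelSum hi hh x hx]
    ring
  · simp [hf x hx]

/-- These are eigenvectors of a symmetric operator for distinct eigenvalues. -/
theorem levelSum_dotProduct_eq_zero {i j k : ℕ} (hi : i ≤ k) (hj : j ≤ k) (hij : i ≠ j)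
    (hk : 2 * k ≤ finrank K V) {h h' : Submodule K V → ℝ} (hh : h ∈ harmonicFun K V i)
    (hh' : h' ∈ harmonicFun K V j) : levelSum k h ⬝ᵥ levelSum k h' = 0 := by
  have hq : (2 : ℝ) ≤ Nat.card K := by exact_mod_cast Finite.one_lt_card
  have h1 := dotProduct_fullDisj_levelSum hj hh' (levelSum_eq_zero k h)
  rw [dotProduct_fullDisj_comm, dotProduct_fullDisj_levelSum hi hh (levelSum_eq_zero k h'),
    dotProduct_comm] at h1
  by_contra hne
  exact disjEigenvalue_injOn hq hi hj hij hk (mul_right_cancel₀ hne h1)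

/-- Symmetry of the disjointness form allows it to be evaluated from either layer. This fixes the
ratio of the squared norms of the two lifts of one harmonic function. -/
theorem disjEigenvalue_mul_levelSum_dotProduct {i k ℓ : ℕ} (hi : i ≤ k) (hiℓ : i ≤ ℓ)
    {h h' : Submodule K V → ℝ} (hh : h ∈ harmonicFun K V i) (hh' : h' ∈ harmonicFun K V i) :
    disjEigenvalue (Nat.card K) (finrank K V) k ℓ i * (levelSum k h ⬝ᵥ levelSum k h')
      = disjEigenvalue (Nat.card K) (finrank K V) ℓ k i * (levelSum ℓ h ⬝ᵥ levelSum ℓ h') := by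
  rw [← dotProduct_fullDisj_levelSum hiℓ hh' (levelSum_eq_zero k h), dotProduct_fullDisj_comm,
    dotProduct_fullDisj_levelSum hi hh (levelSum_eq_zero ℓ h'), dotProduct_comm]

theorem sum_levelSum {i ℓ : ℕ} (hi : i ≤ ℓ) (hℓ : 2 * ℓ ≤ finrank K V) {h : Submodule K V → ℝ}
    (hh : h ∈ harmonicFun K V i) :
    ∑ z, levelSum ℓ h z
      = if i = 0 then gauss (Nat.card K) (finrank K V) ℓ * h ⊥ else 0 := by
  split_ifs with h0
  · subst h0
    rw [Finset.sum_congr rfl fun z _ => levelSum_of_mem_harmonic_zero hh z, ← Finset.sum_filter,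
      Finset.sum_const, nsmul_eq_mul, ← natCard_finrank_eq, Nat.card_eq_fintype_card,
      Fintype.card_subtype]
  · rw [← levelSum_dotProduct_eq_zero hi (Nat.zero_le ℓ) h0 hℓ hh single_bot_mem_harmonic]
    refine Finset.sum_congr rfl fun z _ => ?_
    rw [levelSum_of_mem_harmonic_zero single_bot_mem_harmonic, if_pos rfl]
    by_cases hz : finrank K z = ℓ
    · simp [hz]
    · simp [levelSum_eq_zero ℓ h z hz]

theorem dotProduct_fullOnes_levelSum {i k ℓ : ℕ} (hi : i ≤ ℓ) (hℓ : 2 * ℓ ≤ finrank K V)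
    {h : Submodule K V → ℝ} (hh : h ∈ harmonicFun K V i) {f : Submodule K V → ℝ}
    (hf : ∀ x : Submodule K V, finrank K x ≠ k → f x = 0) :
    f ⬝ᵥ fullOnes K V *ᵥ levelSum ℓ h
      = (if i = 0 then gauss (Nat.card K) (finrank K V) ℓ else 0) * (f ⬝ᵥ levelSum k h) := by
  simp only [dotProduct, Finset.mul_sum]
  refine Finset.sum_congr rfl fun x _ => ?_
  have : (fullOnes K V *ᵥ levelSum ℓ h) x = ∑ z, levelSum ℓ h z := by
    simp [Matrix.mulVec, dotProduct, fullOnes]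
  rw [this, sum_levelSum hi hℓ hh]
  split_ifs with h0
  · subst h0
    rw [levelSum_of_mem_harmonic_zero hh]
    split_ifs with hx
    · ring
    · simp [hf x hx]
  · simp

/-- A function supported in dimension `k` is a sum of lifts of harmonic functions. -/
theorem exists_sum_levelSum {k : ℕ} {f : Submodule K V → ℝ}
    (hf : ∀ x : Submodule K V, finrank K x ≠ k → f x = 0) :
    ∃ h : ℕ → Submodule K V → ℝ, (∀ i, h i ∈ harmonicFun K V i) ∧
      f = ∑ i ∈ Finset.range (k + 1), levelSum k (h i) := by
  suffices hmem : f ∈ ⨆ i ∈ Finset.range (k + 1), (harmonicFun K V i).map (levelSum k) by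
    obtain ⟨μ, hμ⟩ := (Submodule.mem_iSup_finset_iff_exists_sum _ _).1 hmem
    choose h hh hl using fun i => (μ i).2
    exact ⟨h, hh, by rw [← hμ]; exact Finset.sum_congr rfl fun i _ => (hl i).symm⟩
  -- Otherwise a linear functional, with coefficients `p`, kills all lifts but not `f`. It is shown
  -- that `p` vanishes in dimension `k`.
  by_contra hmem
  obtain ⟨φ, hφf, hφ⟩ := Submodule.exists_le_ker_of_notMem hmem
  obtain ⟨p, hp⟩ : ∃ p : Submodule K V → ℝ, ∀ g, φ g = ∑ x, g x * p x :=
    ⟨_, fun g => LinearMap.pi_apply_eq_sum_univ φ g⟩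
  set p' : Submodule K V → ℝ := fun x => if finrank K x = k then p x else 0 with hp'
  -- The adjoint of the lift, applied to `p`; the functional kills the lifts exactly when `d` is
  -- orthogonal to harmonic functions.
  set d : Submodule K V → ℝ := fun y => ∑ x with y ≤ x, p' x with hd
  have orth : ∀ i ≤ k, ∀ h ∈ harmonicFun K V i, ∑ y, h y * d y = 0 := by
    intro i hi h hh
    have h0 : φ (levelSum k h) = 0 := hφ (Submodule.mem_iSup_of_mem i
      (Submodule.mem_iSup_of_mem (Finset.mem_range.2 (Nat.lt_succ_of_le hi))
        (Submodule.mem_map_of_mem hh)))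
    rw [← h0, hp]
    have h1 : ∀ x, levelSum k h x * p x = ∑ y with y ≤ x, h y * p' x := by
      intro x
      rw [levelSum_apply, hp', ← Finset.sum_mul]
      by_cases hx : finrank K x = k <;> simp [hx]
    rw [Finset.sum_congr rfl fun x _ => h1 x]
    simp only [hd, Finset.mul_sum]
    exact Finset.sum_comm' fun x y => by simp
  -- By induction the part of `d` in dimension `i` is harmonic: its sum over `y ≥ u` is a multiple
  -- of `d u`, already zero. Being also orthogonal to harmonic functions, it is orthogonal to
  -- itself.
  have vanish : ∀ i, i ≤ k → ∀ y : Submodule K V, finrank K y = i → d y = 0 := by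
    intro i
    induction i using Nat.strong_induction_on with
    | _ i ih =>
    intro hi
    have hh : (fun y : Submodule K V => if finrank K y = i then d y else 0) ∈ harmonicFun K V i := by
      refine ⟨fun x hx => if_neg hx, fun u hu => ?_⟩
      calc ∑ y with u ≤ y, (if finrank K y = i then d y else 0)
          = ∑ y with u ≤ y ∧ finrank K y = i, ∑ x with y ≤ x, p' x := by
            rw [← Finset.filter_filter, Finset.sum_filter _ _ (s := Finset.filter _ _)]
        _ = ∑ x, ∑ y with u ≤ y ∧ y ≤ x ∧ finrank K y = i, p' x :=
            Finset.sum_comm' fun y x => by simp; tauto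
        _ = ∑ x, gauss (Nat.card K) (k - finrank K u) (i - finrank K u) *
              if u ≤ x then p' x else 0 := by
            refine Finset.sum_congr rfl fun x _ => ?_
            rw [Finset.sum_const, nsmul_eq_mul]
            split_ifs with hux
            · by_cases hx : finrank K x = k
              · rw [natCard_between_eq_card u x hux i hu.le, hx]
              · simp [hp', hx]
            · rw [Finset.card_eq_zero.2, Nat.cast_zero, zero_mul, mul_zero]
              exact Finset.filter_eq_empty_iff.2 fun y _ hy => hux (hy.1.trans hy.2.1)
        _ = gauss (Nat.card K) (k - finrank K u) (i - finrank K u) * d u := by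
            rw [← Finset.mul_sum, ← Finset.sum_filter]
        _ = 0 := by rw [ih _ hu (hu.le.trans hi) u rfl, mul_zero]
    have h2 := orth i hi _ hh
    intro y hy
    have h3 := (Finset.sum_eq_zero_iff_of_nonneg (fun y _ => by
      split_ifs
      · exact mul_self_nonneg _
      · simp)).1 h2 y (Finset.mem_univ y)
    rw [if_pos hy] at h3
    exact mul_self_eq_zero.1 h3
  refine hφf ?_
  rw [hp]
  refine Finset.sum_eq_zero fun x _ => ?_
  by_cases hx : finrank K x = k
  · have h1 := vanish k le_rfl x hx
    have h2 : d x = p x := by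
      rw [hd]
      simp only
      rw [Finset.sum_eq_single x]
      · simp [hp', hx]
      · intro y hy hyx
        refine if_neg fun hyk => hyx ?_
        exact (Submodule.eq_of_le_of_finrank_eq (Finset.mem_filter.1 hy).2
          (hx.trans hyk.symm)).symm
      · simp
    rw [← h2, h1, mul_zero]
  · rw [hf x hx, zero_mul]

end Harmonic

/-! ### Splitting the quadratic form into blocks -/

section QuadraticForm

open scoped Classical
open scoped Matrix

/-- The arithmetic-geometric mean inequality: (2mZ)² ≤ 4 EF XY ≤ (EX + FY)². The factor `ρ` allows
for the different norms of a harmonic function's two lifts. -/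
theorem quadratic_form_nonneg_of_discriminant {E F m X Y Z ρ : ℝ} (hE : 0 ≤ E) (hF : 0 ≤ F)
    (hX : 0 ≤ X) (hY : 0 ≤ Y) (hZ : Z ^ 2 ≤ X * (ρ * Y)) (h : m ^ 2 * ρ ≤ E * F) :
    0 ≤ E * X + F * Y - 2 * (m * Z) := by
  have h1 : (2 * (m * Z)) ^ 2 ≤ (E * X + F * Y) ^ 2 := by
    have h2 : m ^ 2 * Z ^ 2 ≤ m ^ 2 * (X * (ρ * Y)) :=
      mul_le_mul_of_nonneg_left hZ (sq_nonneg m)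
    have h3 : (m ^ 2 * ρ) * (X * Y) ≤ (E * F) * (X * Y) :=
      mul_le_mul_of_nonneg_right h (mul_nonneg hX hY)
    nlinarith [sq_nonneg (E * X - F * Y)]
  linarith [le_abs_self (2 * (m * Z)), abs_le_of_sq_le_sq h1 (by positivity)]

theorem sq_dotProduct_le {α : Type*} [Fintype α] (f g : α → ℝ) :
    (f ⬝ᵥ g) ^ 2 ≤ (f ⬝ᵥ f) * (g ⬝ᵥ g) := by
  simpa only [dotProduct, ← sq] using Finset.sum_mul_sq_le_sq_mul_sq Finset.univ f g

theorem dotProduct_self_nonneg_real {α : Type*} [Fintype α] (f : α → ℝ) : 0 ≤ f ⬝ᵥ f :=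
  Finset.sum_nonneg fun _ _ => mul_self_nonneg _

variable {K V : Type*} [Field K] [AddCommGroup V] [Module K V] [Fintype (Submodule K V)]
  [FiniteDimensional K V] [Finite K]

theorem sum_levelSum_dotProduct {k : ℕ} (hk : 2 * k ≤ finrank K V)
    {h : ℕ → Submodule K V → ℝ} (hh : ∀ i, h i ∈ harmonicFun K V i) {i : ℕ} (hi : i ≤ k)
    {h' : Submodule K V → ℝ} (hh' : h' ∈ harmonicFun K V i) :
    (∑ j ∈ Finset.range (k + 1), levelSum k (h j)) ⬝ᵥ levelSum k h'
      = levelSum k (h i) ⬝ᵥ levelSum k h' := by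
  rw [sum_dotProduct, Finset.sum_eq_single i]
  · intro j hj hji
    exact levelSum_dotProduct_eq_zero (by simpa [Nat.lt_succ_iff] using hj) hi hji hk (hh j) hh'
  · intro hj
    exact absurd (Finset.mem_range.2 (Nat.lt_succ_of_le hi)) hj

/-- A form which acts as a scalar on each harmonic component is diagonal. -/
theorem form_eq_sum {k ℓ : ℕ} (hℓk : ℓ ≤ k) (hk : 2 * k ≤ finrank K V)
    {h h' : ℕ → Submodule K V → ℝ} (hh : ∀ i, h i ∈ harmonicFun K V i)
    (hh' : ∀ i, h' i ∈ harmonicFun K V i) (c : ℕ → ℝ)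
    (T : Matrix (Submodule K V) (Submodule K V) ℝ)
    (hT : ∀ i ≤ ℓ, (∑ j ∈ Finset.range (k + 1), levelSum k (h j)) ⬝ᵥ T *ᵥ levelSum ℓ (h' i)
      = c i * ((∑ j ∈ Finset.range (k + 1), levelSum k (h j)) ⬝ᵥ levelSum k (h' i))) :
    (∑ j ∈ Finset.range (k + 1), levelSum k (h j)) ⬝ᵥ
        T *ᵥ (∑ i ∈ Finset.range (ℓ + 1), levelSum ℓ (h' i))
      = ∑ i ∈ Finset.range (ℓ + 1), c i * (levelSum k (h i) ⬝ᵥ levelSum k (h' i)) := by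
  rw [Matrix.mulVec_sum, dotProduct_sum]
  refine Finset.sum_congr rfl fun i hi => ?_
  have hi : i ≤ ℓ := Nat.lt_succ_iff.1 (Finset.mem_range.1 hi)
  rw [hT i hi, sum_levelSum_dotProduct hk hh (hi.trans hℓk) (hh' i)]

/-- The quadratic form of the slack matrix is nonnegative if all its diagonal blocks are positive
semidefinite. -/
theorem slack_form_nonneg {k ℓ : ℕ} (hℓk : ℓ ≤ k) (hk : 2 * k ≤ finrank K V) {α a b lam : ℝ}
    (hE : ∀ i ≤ k, 0 ≤ α - a * disjEigenvalue (Nat.card K) (finrank K V) k k i)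
    (hF : ∀ i ≤ ℓ, 0 ≤ α - lam * disjEigenvalue (Nat.card K) (finrank K V) ℓ ℓ i)
    (hEF : ∀ i ≤ ℓ, (1 / 2 * (if i = 0 then gauss (Nat.card K) (finrank K V) ℓ else 0)
        + b * disjEigenvalue (Nat.card K) (finrank K V) k ℓ i) ^ 2
      * (disjEigenvalue (Nat.card K) (finrank K V) ℓ k i
        / disjEigenvalue (Nat.card K) (finrank K V) k ℓ i)
      ≤ (α - a * disjEigenvalue (Nat.card K) (finrank K V) k k i)
        * (α - lam * disjEigenvalue (Nat.card K) (finrank K V) ℓ ℓ i))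
    {f g : Submodule K V → ℝ} (hf : ∀ x : Submodule K V, finrank K x ≠ k → f x = 0)
    (hg : ∀ x : Submodule K V, finrank K x ≠ ℓ → g x = 0) :
    0 ≤ α * (f ⬝ᵥ f) + α * (g ⬝ᵥ g) - f ⬝ᵥ fullOnes K V *ᵥ g
      - 2 * b * (f ⬝ᵥ fullDisj K V *ᵥ g) - a * (f ⬝ᵥ fullDisj K V *ᵥ f)
      - lam * (g ⬝ᵥ fullDisj K V *ᵥ g) := by
  have hq : (1 : ℝ) < Nat.card K := by exact_mod_cast Finite.one_lt_card
  obtain ⟨h, hh, rfl⟩ := exists_sum_levelSum hf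
  obtain ⟨h', hh', rfl⟩ := exists_sum_levelSum hg
  have hℓn : 2 * ℓ ≤ finrank K V := by omega
  rw [form_eq_sum hℓk hk hh hh' _ _
      (fun i hi => dotProduct_fullOnes_levelSum hi hℓn (hh' i) hf),
    form_eq_sum hℓk hk hh hh' _ _ (fun i hi => dotProduct_fullDisj_levelSum hi (hh' i) hf),
    form_eq_sum le_rfl hk hh hh _ _ (fun i hi => dotProduct_fullDisj_levelSum hi (hh i) hf),
    form_eq_sum le_rfl hℓn hh' hh' _ _ (fun i hi => dotProduct_fullDisj_levelSum hi (hh' i) hg)]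
  have h1 := form_eq_sum le_rfl hk hh hh (fun _ => 1) 1 (fun i _ => by rw [Matrix.one_mulVec, one_mul])
  have h2 := form_eq_sum le_rfl hℓn hh' hh' (fun _ => 1) 1
    (fun i _ => by rw [Matrix.one_mulVec, one_mul])
  rw [Matrix.one_mulVec] at h1 h2
  rw [h1, h2]
  -- Degrees above `ℓ` do not couple with the smaller layer, so their nonnegative terms can be
  -- dropped.
  have hsub : ∑ i ∈ Finset.range (ℓ + 1),
        (α - a * disjEigenvalue (Nat.card K) (finrank K V) k k i)
          * (levelSum k (h i) ⬝ᵥ levelSum k (h i))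
      ≤ ∑ i ∈ Finset.range (k + 1),
        (α - a * disjEigenvalue (Nat.card K) (finrank K V) k k i)
          * (levelSum k (h i) ⬝ᵥ levelSum k (h i)) := by
    refine Finset.sum_le_sum_of_subset_of_nonneg
      (Finset.range_mono (Nat.succ_le_succ hℓk)) fun i hi _ => ?_
    exact mul_nonneg (hE i (Nat.lt_succ_iff.1 (Finset.mem_range.1 hi)))
      (dotProduct_self_nonneg_real _)
  have hblock : 0 ≤ ∑ i ∈ Finset.range (ℓ + 1),
      ((α - a * disjEigenvalue (Nat.card K) (finrank K V) k k i)
          * (levelSum k (h i) ⬝ᵥ levelSum k (h i))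
        + (α - lam * disjEigenvalue (Nat.card K) (finrank K V) ℓ ℓ i)
          * (levelSum ℓ (h' i) ⬝ᵥ levelSum ℓ (h' i))
        - 2 * ((1 / 2 * (if i = 0 then gauss (Nat.card K) (finrank K V) ℓ else 0)
            + b * disjEigenvalue (Nat.card K) (finrank K V) k ℓ i)
          * (levelSum k (h i) ⬝ᵥ levelSum k (h' i)))) := by
    refine Finset.sum_nonneg fun i hi => ?_
    have hi : i ≤ ℓ := Nat.lt_succ_iff.1 (Finset.mem_range.1 hi)
    refine quadratic_form_nonneg_of_discriminant (hE i (hi.trans hℓk)) (hF i hi)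
      (dotProduct_self_nonneg_real _) (dotProduct_self_nonneg_real _) ?_ (hEF i hi)
    -- Cauchy-Schwarz takes place in layer `k`; the norm ratio then moves the lift of `h' i` to
    -- layer `ℓ`.
    refine (sq_dotProduct_le _ _).trans_eq ?_
    have h3 := disjEigenvalue_mul_levelSum_dotProduct (hi.trans hℓk) hi (hh' i) (hh' i)
    have h4 : disjEigenvalue (Nat.card K) (finrank K V) k ℓ i ≠ 0 :=
      disjEigenvalue_ne_zero hq hi (by omega)
    rw [div_mul_eq_mul_div, ← h3, mul_div_cancel_left₀ _ h4]
  refine (add_nonneg hblock (sub_nonneg.2 hsub)).trans_eq ?_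
  simp only [Finset.mul_sum, Finset.sum_sub_distrib, Finset.sum_add_distrib, sub_mul, add_mul,
    mul_add]
  simp only [← mul_assoc, one_mul]
  norm_num
  ring

end QuadraticForm

/-! ### From indexed layers to functions on subspaces -/

section Reduction

open scoped Classical
open scoped Matrix

variable {K V ι : Type*} [Field K] [AddCommGroup V] [Module K V]

theorem inclMatrix_apply_self {sub : ι → Submodule K V} [FiniteDimensional K V] {P : Set ι} {k : ℕ}
    (hP : ∀ p ∈ P, finrank K (sub p) = k) (p q : ι) :
    inclMatrix sub P P p q
      = if p ∈ P ∧ q ∈ P then (1 : Matrix (Submodule K V) (Submodule K V) ℝ) (sub p) (sub q)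
        else 0 := by
  simp only [inclMatrix, Matrix.of_apply, ← and_assoc]
  by_cases h : p ∈ P ∧ q ∈ P
  · simp only [h, and_self, true_and, if_true, hP p h.1, hP q h.2, min_self, Matrix.one_apply]
    refine if_congr ⟨fun hd => ?_, fun he => ?_⟩ rfl rfl
    · have h1 := Submodule.eq_of_le_of_finrank_eq (inf_le_left : sub p ⊓ sub q ≤ sub p)
        (hd.trans (hP p h.1).symm)
      have h2 := Submodule.eq_of_le_of_finrank_eq (inf_le_right : sub p ⊓ sub q ≤ sub q)
        (hd.trans (hP q h.2).symm)
      exact h1.symm.trans h2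
    · rw [← he, inf_idem, hP p h.1]
  · simp [h]

theorem disjMatrix_apply [FiniteDimensional K V] (sub : ι → Submodule K V) (P Q : Set ι)
    (p q : ι) :
    disjMatrix sub P Q p q = if p ∈ P ∧ q ∈ Q then fullDisj K V (sub p) (sub q) else 0 := by
  by_cases h : p ∈ P ∧ q ∈ Q
  · simp [disjMatrix, fullDisj, h, Submodule.finrank_eq_zero]
  · rw [if_neg h]
    simp only [disjMatrix, Matrix.of_apply, ← and_assoc, h, false_and, if_false]

theorem onesMatrix_apply (sub : ι → Submodule K V) (P Q : Set ι) (p q : ι) :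
    onesMatrix P Q p q = if p ∈ P ∧ q ∈ Q then fullOnes K V (sub p) (sub q) else 0 := by
  simp [onesMatrix, fullOnes]

theorem disjMatrix_transpose (sub : ι → Submodule K V) (P Q : Set ι) :
    (disjMatrix sub P Q)ᵀ = disjMatrix sub Q P := by
  ext p q
  simp only [disjMatrix, Matrix.transpose_apply, Matrix.of_apply]
  exact if_congr (by rw [inf_comm (sub q)]; tauto) rfl rfl

theorem onesMatrix_transpose (P Q : Set ι) :
    (onesMatrix P Q)ᵀ = onesMatrix Q P := by
  ext p q
  exact if_congr and_comm rfl rfl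

theorem inclMatrix_transpose (sub : ι → Submodule K V) (P Q : Set ι) :
    (inclMatrix sub P Q)ᵀ = inclMatrix sub Q P := by
  ext p q
  simp only [inclMatrix, Matrix.transpose_apply, Matrix.of_apply]
  exact if_congr (by rw [inf_comm (sub q), min_comm (finrank K (sub q))]; tauto) rfl rfl

variable [Fintype ι]

/-- The sum of the values of `x` at the members of the layer `P` which name a given subspace. -/
noncomputable def layerPush (sub : ι → Submodule K V) (P : Set ι) (x : ι → ℝ) :
    Submodule K V → ℝ :=
  fun u => ∑ p, if p ∈ P ∧ sub p = u then x p else 0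

theorem layerPush_eq_zero {sub : ι → Submodule K V} {P : Set ι} {k : ℕ}
    (hP : ∀ p ∈ P, finrank K (sub p) = k) (x : ι → ℝ) (u : Submodule K V)
    (hu : finrank K u ≠ k) : layerPush sub P x u = 0 :=
  Finset.sum_eq_zero fun p _ => if_neg (by
    rintro ⟨hp, rfl⟩
    exact hu (hP p hp))

variable [Fintype (Submodule K V)]

/-- A matrix block depending only on the named subspaces sees a vector only through its
push-forward. This handles the plain index set and the one with a second copy alike. -/
theorem layerPush_dotProduct_mulVec (sub : ι → Submodule K V) (P Q : Set ι) (x y : ι → ℝ)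
    (T : Matrix (Submodule K V) (Submodule K V) ℝ) (M : Matrix ι ι ℝ)
    (hM : ∀ p q, M p q = if p ∈ P ∧ q ∈ Q then T (sub p) (sub q) else 0) :
    x ⬝ᵥ M *ᵥ y = layerPush sub P x ⬝ᵥ T *ᵥ layerPush sub Q y := by
  have push : ∀ (P : Set ι) (x : ι → ℝ) (g : Submodule K V → ℝ),
      ∑ u, layerPush sub P x u * g u = ∑ p, if p ∈ P then x p * g (sub p) else 0 := by
    intro P x g
    simp only [layerPush, Finset.sum_mul]
    rw [Finset.sum_comm]
    refine Finset.sum_congr rfl fun p _ => ?_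
    by_cases hp : p ∈ P <;> simp [hp, ite_mul]
  simp only [dotProduct, Matrix.mulVec]
  rw [push]
  refine Finset.sum_congr rfl fun p _ => ?_
  have h2 : ∑ v, T (sub p) v * layerPush sub Q y v
      = ∑ q, if q ∈ Q then y q * T (sub p) (sub q) else 0 := by
    rw [← push]
    exact Finset.sum_congr rfl fun v _ => mul_comm _ _
  rw [h2]
  by_cases hp : p ∈ P
  · rw [if_pos hp]
    congr 1
    refine Finset.sum_congr rfl fun q _ => ?_
    by_cases hq : q ∈ Q <;> simp [hM, hp, hq, mul_comm]
  · simp [hM, hp]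

theorem dotProduct_slackMatrix_mulVec [FiniteDimensional K V] {sub : ι → Submodule K V}
    {P Q : Set ι} {k ℓ : ℕ} (hP : ∀ p ∈ P, finrank K (sub p) = k)
    (hQ : ∀ p ∈ Q, finrank K (sub p) = ℓ) (α a b lam : ℝ) (x : ι → ℝ) :
    x ⬝ᵥ slackMatrix sub P Q α α b (a • disjMatrix sub P P + lam • disjMatrix sub Q Q) *ᵥ x
      = α * (layerPush sub P x ⬝ᵥ layerPush sub P x) + α * (layerPush sub Q x ⬝ᵥ layerPush sub Q x)
        - layerPush sub P x ⬝ᵥ fullOnes K V *ᵥ layerPush sub Q x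
        - 2 * b * (layerPush sub P x ⬝ᵥ fullDisj K V *ᵥ layerPush sub Q x)
        - a * (layerPush sub P x ⬝ᵥ fullDisj K V *ᵥ layerPush sub P x)
        - lam * (layerPush sub Q x ⬝ᵥ fullDisj K V *ᵥ layerPush sub Q x) := by
  have hJ : layerPush sub Q x ⬝ᵥ fullOnes K V *ᵥ layerPush sub P x
      = layerPush sub P x ⬝ᵥ fullOnes K V *ᵥ layerPush sub Q x := by
    rw [Matrix.dotProduct_mulVec, ← Matrix.mulVec_transpose, dotProduct_comm]
    rfl
  simp only [slackMatrix, Matrix.sub_mulVec, Matrix.add_mulVec, Matrix.smul_mulVec,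
    dotProduct_sub, dotProduct_add, dotProduct_smul, smul_eq_mul,
    layerPush_dotProduct_mulVec sub P P x x _ _ (inclMatrix_apply_self hP),
    layerPush_dotProduct_mulVec sub Q Q x x _ _ (inclMatrix_apply_self hQ),
    layerPush_dotProduct_mulVec sub _ _ x x _ _ (disjMatrix_apply sub _ _),
    layerPush_dotProduct_mulVec sub _ _ x x _ _ (onesMatrix_apply sub _ _), Matrix.one_mulVec, hJ,
    dotProduct_fullDisj_comm (layerPush sub Q x) (layerPush sub P x)]
  ring

end Reduction

/-! ### Verification of the block conditions -/

section BlockConditions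

variable {q : ℝ} {n k ℓ : ℕ}

theorem alphaVal_pos (hq : 1 < q) (hℓ : 1 ≤ ℓ) (hℓk : ℓ ≤ k) (hk : 2 * k ≤ n) :
    0 < alphaVal q n k ℓ := by
  have h1 := Real.sqrt_pos.2 (gauss_pos hq (a := n - 1) (b := k - 1) (by omega))
  have h2 := Real.sqrt_pos.2 (gauss_pos hq (a := n - 1) (b := ℓ - 1) (by omega))
  unfold alphaVal
  positivity

theorem aVal_nonneg (hq : 1 < q) (hℓ : 1 ≤ ℓ) (hℓk : ℓ ≤ k) (hk : 2 * k ≤ n) {lam : ℝ}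
    (hlam : 0 ≤ lam) : 0 ≤ aVal q n k ℓ lam := by
  have h1 := gauss_pos hq (a := n - k) (b := k) (by omega)
  have h2 := gauss_pos hq (a := n - ℓ) (b := ℓ) (by omega)
  have h3 := pow_sub_one_pos hq (a := k) (by omega)
  have h4 := pow_sub_one_pos hq (a := ℓ) (by omega)
  have h5 : 0 ≤ q ^ (k - ℓ) - 1 := sub_nonneg.2 (one_le_pow₀ hq.le)
  unfold aVal
  positivity

/-- Equivalently, (q^k - 1) E_0 = (q^ℓ - 1) F_0; in this form the value of `a` enters blocks 0 and
1. -/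
theorem aVal_mul (hq : 1 < q) (hℓ : 1 ≤ ℓ) (hℓk : ℓ ≤ k) (hk : 2 * k ≤ n) (lam : ℝ) :
    aVal q n k ℓ lam * disjEigenvalue q n k k 0 * (q ^ k - 1)
      = (q ^ k - q ^ ℓ) * alphaVal q n k ℓ + (q ^ ℓ - 1) * (lam * disjEigenvalue q n ℓ ℓ 0) := by
  have h1 := (gauss_pos hq (a := n - k) (b := k) (by omega)).ne'
  have h3 := (pow_sub_one_pos hq (a := k) (by omega)).ne'
  have h4 : q ^ k = q ^ ℓ * q ^ (k - ℓ) := by rw [← pow_add]; congr 1; omega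
  rw [disjEigenvalue_zero, disjEigenvalue_zero, aVal, alphaVal, ← sq, ← sq]
  field_simp
  rw [h4]
  ring

theorem gauss_mul_pow_sub_one (hq : 1 < q) {a b : ℕ} (ha : 1 ≤ a) (hb : 1 ≤ b) :
    gauss q a b * (q ^ b - 1) = gauss q (a - 1) (b - 1) * (q ^ a - 1) := by
  obtain ⟨a, rfl⟩ := Nat.exists_eq_add_of_le' ha
  obtain ⟨b, rfl⟩ := Nat.exists_eq_add_of_le' hb
  have h := (pow_sub_one_pos hq (Nat.succ_pos b)).ne'
  rw [gauss_succ_succ, Nat.add_sub_cancel, Nat.add_sub_cancel]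
  field_simp

theorem pow_mul_gauss_mul_pow_sub_one (hq : 1 < q) (hℓ : 1 ≤ ℓ) (hn : ℓ ≤ n) :
    q ^ ℓ * gauss q (n - 1) ℓ * (q ^ ℓ - 1) = gauss q (n - 1) (ℓ - 1) * (q ^ n - q ^ ℓ) := by
  obtain ⟨m, rfl⟩ := Nat.exists_eq_add_of_le' hℓ
  have h := (pow_sub_one_pos hq (Nat.succ_pos m)).ne'
  have h2 : q ^ n = q ^ (m + 1) * q ^ (n - 1 - m) := by rw [← pow_add]; congr 1; omega
  rw [gauss_succ_right hq, Nat.add_sub_cancel, h2]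
  field_simp

theorem bVal_mul (hq : 1 < q) (hℓ : 1 ≤ ℓ) (hℓk : ℓ ≤ k) (hk : 2 * k ≤ n) (lam : ℝ) :
    bVal q n k ℓ lam * disjEigenvalue q n k ℓ 0 * (q ^ ℓ - 1) * √(gauss q (n - 1) (k - 1))
      = -(√(gauss q (n - 1) (ℓ - 1)) * ((q ^ n - q ^ ℓ) * alphaVal q n k ℓ
          + (q ^ ℓ - 1) * (lam * disjEigenvalue q n ℓ ℓ 0))) := by
  have h1 := (gauss_pos hq (a := n - k) (b := ℓ) (by omega)).ne'
  have h3 := (Real.sqrt_pos.2 (gauss_pos hq (a := n - 1) (b := k - 1) (by omega))).ne'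
  have h4 := pow_mul_gauss_mul_pow_sub_one hq hℓ (by omega : ℓ ≤ n)
  have h5 := Real.mul_self_sqrt (gauss_pos hq (a := n - 1) (b := ℓ - 1) (by omega)).le
  rw [disjEigenvalue_zero, disjEigenvalue_zero, bVal, alphaVal, ← sq]
  rw [← h5] at h4
  field_simp
  linear_combination (-√(gauss q (n - 1) (k - 1))) * h4

/-- Counting disjoint pairs from either layer gives θ(ℓ,k,0) [n,ℓ] = θ(k,ℓ,0) [n,k]. The layer sizes
are then expressed through [n-1,ℓ-1] and [n-1,k-1]. -/
theorem disjEigenvalue_zero_swap (hq : 1 < q) (hℓ : 1 ≤ ℓ) (hℓk : ℓ ≤ k) (hk : 2 * k ≤ n) :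
    disjEigenvalue q n ℓ k 0 * (√(gauss q (n - 1) (ℓ - 1)) ^ 2 * (q ^ k - 1))
      = disjEigenvalue q n k ℓ 0 * (√(gauss q (n - 1) (k - 1)) ^ 2 * (q ^ ℓ - 1)) := by
  have h0 := (pow_sub_one_pos hq (a := n) (by omega)).ne'
  have h1 := gauss_mul_gauss_comm hq (by omega : k + ℓ ≤ n)
  have h2 := gauss_mul_pow_sub_one hq (a := n) (b := k) (by omega) (by omega)
  have h3 := gauss_mul_pow_sub_one hq (a := n) (b := ℓ) (by omega) hℓ
  rw [Real.sq_sqrt (gauss_pos hq (by omega)).le, Real.sq_sqrt (gauss_pos hq (by omega)).le,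
    disjEigenvalue_zero, disjEigenvalue_zero, mul_comm ℓ k]
  refine mul_right_cancel₀ h0 ?_
  linear_combination q ^ (k * ℓ) * (q ^ k - 1) * (q ^ ℓ - 1) * h1
    - q ^ (k * ℓ) * gauss q (n - ℓ) k * (q ^ k - 1) * h3
    + q ^ (k * ℓ) * gauss q (n - k) ℓ * (q ^ ℓ - 1) * h2

theorem disjEigenvalue_one (hq : 1 < q) {k ℓ : ℕ} (hℓ : 1 ≤ ℓ) (hn : k + ℓ ≤ n) :
    disjEigenvalue q n k ℓ 1 = -(disjEigenvalue q n k ℓ 0 * (q ^ ℓ - 1)) / (q ^ n - q ^ k) := by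
  have h := disjEigenvalue_succ hq (i := 0) hℓ (Nat.zero_le k) hn
  have h1 : q ^ n = q ^ k * q ^ (n - k) := by rw [← pow_add]; congr 1; omega
  have h2 : 0 < q ^ n - q ^ k := sub_pos.2 (pow_lt_pow_right₀ hq (by omega))
  rw [eq_div_iff h2.ne', h1]
  simp only [Nat.sub_zero, zero_add] at h
  linear_combination h

/-- With s² = [n-1,k-1] and t² = [n-1,ℓ-1], the off-diagonal coefficient is t F_0 / s. All factors
become multiples of F_0, and the determinant cancels. -/
theorem block_zero (hq : 1 < q) (hℓ : 1 ≤ ℓ) (hℓk : ℓ ≤ k) (hk : 2 * k ≤ n) (lam : ℝ) :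
    (1 / 2 * gauss q n ℓ + bVal q n k ℓ lam * disjEigenvalue q n k ℓ 0) ^ 2
      * (disjEigenvalue q n ℓ k 0 / disjEigenvalue q n k ℓ 0)
      = (alphaVal q n k ℓ - aVal q n k ℓ lam * disjEigenvalue q n k k 0)
        * (alphaVal q n k ℓ - lam * disjEigenvalue q n ℓ ℓ 0) := by
  have hA := aVal_mul hq hℓ hℓk hk lam
  have hB := bVal_mul hq hℓ hℓk hk lam
  have hS := disjEigenvalue_zero_swap hq hℓ hℓk hk
  have hG := gauss_mul_pow_sub_one hq (a := n) (b := ℓ) (by omega) hℓ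
  have hw := disjEigenvalue_ne_zero hq (Nat.zero_le ℓ) (by omega : k + ℓ ≤ n)
  have hx := (pow_sub_one_pos hq (a := k) (by omega)).ne'
  have hy := (pow_sub_one_pos hq (a := ℓ) (by omega)).ne'
  have hsk := (Real.sqrt_pos.2 (gauss_pos hq (a := n - 1) (b := k - 1) (by omega))).ne'
  have hsl := (Real.sqrt_pos.2 (gauss_pos hq (a := n - 1) (b := ℓ - 1) (by omega))).ne'
  rw [← Real.mul_self_sqrt (gauss_pos hq (a := n - 1) (b := ℓ - 1) (by omega)).le] at hG
  have hα : alphaVal q n k ℓ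
      = 1 / 2 * √(gauss q (n - 1) (k - 1)) * √(gauss q (n - 1) (ℓ - 1)) := rfl
  generalize √(gauss q (n - 1) (k - 1)) = s at *
  generalize √(gauss q (n - 1) (ℓ - 1)) = t at *
  generalize alphaVal q n k ℓ = α at *
  have hm : 1 / 2 * gauss q n ℓ + bVal q n k ℓ lam * disjEigenvalue q n k ℓ 0
      = t * (α - lam * disjEigenvalue q n ℓ ℓ 0) / s := by
    rw [eq_div_iff hsk]
    refine mul_right_cancel₀ hy ?_
    linear_combination 1 / 2 * s * hG + hB - t * (q ^ n - 1) * hα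
  have hE : α - aVal q n k ℓ lam * disjEigenvalue q n k k 0
      = (q ^ ℓ - 1) * (α - lam * disjEigenvalue q n ℓ ℓ 0) / (q ^ k - 1) := by
    rw [eq_div_iff hx]
    linear_combination -hA
  have hρ : disjEigenvalue q n ℓ k 0 / disjEigenvalue q n k ℓ 0
      = s ^ 2 * (q ^ ℓ - 1) / (t ^ 2 * (q ^ k - 1)) := by
    rw [div_eq_div_iff hw (by positivity)]
    linear_combination hS
  rw [hm, hE, hρ]
  field_simp

theorem block_one (hq : 1 < q) (hℓ : 1 ≤ ℓ) (hℓk : ℓ ≤ k) (hk : 2 * k ≤ n) (lam : ℝ) :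
    (bVal q n k ℓ lam * disjEigenvalue q n k ℓ 1) ^ 2
      * (disjEigenvalue q n ℓ k 1 / disjEigenvalue q n k ℓ 1)
      = (alphaVal q n k ℓ - aVal q n k ℓ lam * disjEigenvalue q n k k 1)
        * (alphaVal q n k ℓ - lam * disjEigenvalue q n ℓ ℓ 1) := by
  have hA := aVal_mul hq hℓ hℓk hk lam
  have hB := bVal_mul hq hℓ hℓk hk lam
  have hS := disjEigenvalue_zero_swap hq hℓ hℓk hk
  have hw := disjEigenvalue_ne_zero hq (Nat.zero_le ℓ) (by omega : k + ℓ ≤ n)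
  have hx := (pow_sub_one_pos hq (a := k) (by omega)).ne'
  have hy := (pow_sub_one_pos hq (a := ℓ) (by omega)).ne'
  have hX : q ^ n - q ^ k ≠ 0 := (sub_pos.2 (pow_lt_pow_right₀ hq (by omega))).ne'
  have hY : q ^ n - q ^ ℓ ≠ 0 := (sub_pos.2 (pow_lt_pow_right₀ hq (by omega))).ne'
  have hsk := (Real.sqrt_pos.2 (gauss_pos hq (a := n - 1) (b := k - 1) (by omega))).ne'
  have hsl := (Real.sqrt_pos.2 (gauss_pos hq (a := n - 1) (b := ℓ - 1) (by omega))).ne'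
  rw [disjEigenvalue_one hq hℓ (by omega : k + ℓ ≤ n),
    disjEigenvalue_one hq (by omega : 1 ≤ k) (by omega : ℓ + k ≤ n),
    disjEigenvalue_one hq (by omega : 1 ≤ k) (by omega : k + k ≤ n),
    disjEigenvalue_one hq hℓ (by omega : ℓ + ℓ ≤ n)]
  generalize √(gauss q (n - 1) (k - 1)) = s at *
  generalize √(gauss q (n - 1) (ℓ - 1)) = t at *
  generalize alphaVal q n k ℓ = α at *
  -- The common numerator of E_1, F_1 and the off-diagonal coefficient, which makes the degree 1
  -- block singular.
  set M := (q ^ n - q ^ ℓ) * α + (q ^ ℓ - 1) * (lam * disjEigenvalue q n ℓ ℓ 0) with hM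
  have hm : bVal q n k ℓ lam * (-(disjEigenvalue q n k ℓ 0 * (q ^ ℓ - 1)) / (q ^ n - q ^ k))
      = t * M / (s * (q ^ n - q ^ k)) := by
    rw [mul_div_assoc', div_eq_div_iff hX (by positivity)]
    linear_combination -(q ^ n - q ^ k) * hB
  have hE : α - aVal q n k ℓ lam * (-(disjEigenvalue q n k k 0 * (q ^ k - 1)) / (q ^ n - q ^ k))
      = M / (q ^ n - q ^ k) := by
    rw [eq_div_iff hX, hM, sub_mul, mul_assoc, div_mul_cancel₀ _ hX]
    linear_combination hA
  have hF : α - lam * (-(disjEigenvalue q n ℓ ℓ 0 * (q ^ ℓ - 1)) / (q ^ n - q ^ ℓ))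
      = M / (q ^ n - q ^ ℓ) := by
    rw [eq_div_iff hY, hM, sub_mul, mul_assoc, div_mul_cancel₀ _ hY]
    ring
  have hρ : -(disjEigenvalue q n ℓ k 0 * (q ^ k - 1)) / (q ^ n - q ^ ℓ)
        / (-(disjEigenvalue q n k ℓ 0 * (q ^ ℓ - 1)) / (q ^ n - q ^ k))
      = s ^ 2 * (q ^ n - q ^ k) / (t ^ 2 * (q ^ n - q ^ ℓ)) := by
    rw [div_div_div_eq, div_eq_div_iff (by
      refine mul_ne_zero hY (neg_ne_zero.2 (mul_ne_zero hw hy))) (by positivity)]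
    linear_combination -(q ^ n - q ^ k) * (q ^ n - q ^ ℓ) * hS
  rw [hm, hE, hF, hρ]
  field_simp

/-- At λ = 0 the left side is α (q^k - q^ℓ) / (q^k - 1). -/
theorem aVal_zero_mul_le (hq : 1 < q) (hℓ : 1 ≤ ℓ) (hℓk : ℓ ≤ k) (hk : 2 * k ≤ n) :
    aVal q n k ℓ 0 * |disjEigenvalue q n k k 0| ≤ alphaVal q n k ℓ := by
  have h1 := aVal_mul hq hℓ hℓk hk 0
  have hx := pow_sub_one_pos hq (a := k) (by omega)
  have h2 := alphaVal_pos hq hℓ hℓk hk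
  have h3 := disjEigenvalue_sign hq (Nat.zero_le k) (by omega : k + k ≤ n)
  rw [pow_zero, one_mul] at h3
  rw [abs_of_pos h3]
  refine le_of_mul_le_mul_right ?_ hx
  rw [h1]
  have h4 : 1 ≤ q ^ ℓ := one_le_pow₀ hq.le
  nlinarith

theorem aVal_zero_mul_le_half (hq : 2 ≤ q) (hℓ : 1 ≤ ℓ) (hℓk : ℓ ≤ k) (hk : 2 * k ≤ n) {i : ℕ}
    (hi : 1 ≤ i) (hik : i ≤ k) :
    |aVal q n k ℓ 0 * disjEigenvalue q n k k i| ≤ 1 / 2 * alphaVal q n k ℓ := by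
  have hq1 : 1 < q := by linarith
  have h0 := aVal_nonneg hq1 hℓ hℓk hk le_rfl
  have h1 := abs_disjEigenvalue_le hq hi hik hik (by omega : k + k ≤ n)
  rw [abs_mul, abs_of_nonneg h0]
  have := mul_le_mul_of_nonneg_left h1 h0
  have := aVal_zero_mul_le hq1 hℓ hℓk hk
  linarith

theorem block_pos_of_two_le (hq : 2 ≤ q) (hℓ : 1 ≤ ℓ) (hℓk : ℓ ≤ k) (hk : 2 * k ≤ n) {i : ℕ}
    (hi : 2 ≤ i) (hiℓ : i ≤ ℓ) :
    (bVal q n k ℓ 0 * disjEigenvalue q n k ℓ i) ^ 2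
      * (disjEigenvalue q n ℓ k i / disjEigenvalue q n k ℓ i)
      < (alphaVal q n k ℓ - aVal q n k ℓ 0 * disjEigenvalue q n k k i)
        * (alphaVal q n k ℓ - 0 * disjEigenvalue q n ℓ ℓ i) := by
  have hq1 : 1 < q := by linarith
  have hα := alphaVal_pos hq1 hℓ hℓk hk
  have h1 := (abs_le.1 (aVal_zero_mul_le_half hq hℓ hℓk hk (by omega : 1 ≤ i) (by omega))).2
  have h2 := (abs_le.1 (aVal_zero_mul_le_half hq hℓ hℓk hk le_rfl (by omega))).1
  have hone := block_one hq1 hℓ hℓk hk 0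
  have cancel : ∀ j ≤ ℓ, (bVal q n k ℓ 0 * disjEigenvalue q n k ℓ j) ^ 2
      * (disjEigenvalue q n ℓ k j / disjEigenvalue q n k ℓ j)
      = bVal q n k ℓ 0 ^ 2 * (disjEigenvalue q n k ℓ j * disjEigenvalue q n ℓ k j) := by
    intro j hj
    have := disjEigenvalue_ne_zero hq1 hj (by omega : k + ℓ ≤ n)
    field_simp
  rw [cancel 1 hℓ] at hone
  rw [cancel i hiℓ]
  have h3 := abs_disjEigenvalue_le hq hi hiℓ (by omega) (by omega : k + ℓ ≤ n)
  have h4 := abs_disjEigenvalue_le hq hi (hiℓ.trans hℓk) hiℓ (by omega : ℓ + k ≤ n)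
  have h5 : |disjEigenvalue q n k ℓ 1 * disjEigenvalue q n ℓ k 1|
      = disjEigenvalue q n k ℓ 1 * disjEigenvalue q n ℓ k 1 := by
    refine abs_of_pos ?_
    have := disjEigenvalue_sign hq1 hℓ (by omega : k + ℓ ≤ n)
    have := disjEigenvalue_sign hq1 (hℓ.trans hℓk) (by omega : ℓ + k ≤ n)
    nlinarith
  have h6 : disjEigenvalue q n k ℓ i * disjEigenvalue q n ℓ k i
      ≤ 1 / 4 * (disjEigenvalue q n k ℓ 1 * disjEigenvalue q n ℓ k 1) := by
    refine (le_abs_self _).trans ?_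
    rw [← h5, abs_mul, abs_mul]
    refine (mul_le_mul h3 h4 (abs_nonneg _) (by positivity)).trans_eq ?_
    ring
  have h7 := mul_le_mul_of_nonneg_left h6 (sq_nonneg (bVal q n k ℓ 0))
  -- The left side is at most a quarter of its value in degree 1, which equals α E_1 ≤ (3/2) α². So
  -- it is at most (3/8) α², while the right side is at least (1/2) α².
  nlinarith

open Filter Topology in
theorem eventually_blocks (hq : 2 ≤ q) (hℓ : 1 ≤ ℓ) (hℓk : ℓ ≤ k) (hk : 2 * k ≤ n) :
    ∀ᶠ lam in 𝓝 (0 : ℝ),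
      (∀ i ≤ k, 0 ≤ alphaVal q n k ℓ - aVal q n k ℓ lam * disjEigenvalue q n k k i) ∧
      (∀ i ≤ ℓ, 0 ≤ alphaVal q n k ℓ - lam * disjEigenvalue q n ℓ ℓ i) ∧
      (∀ i ≤ ℓ, (1 / 2 * (if i = 0 then gauss q n ℓ else 0)
          + bVal q n k ℓ lam * disjEigenvalue q n k ℓ i) ^ 2
        * (disjEigenvalue q n ℓ k i / disjEigenvalue q n k ℓ i)
        ≤ (alphaVal q n k ℓ - aVal q n k ℓ lam * disjEigenvalue q n k k i)
          * (alphaVal q n k ℓ - lam * disjEigenvalue q n ℓ ℓ i)) := by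
  have hq1 : 1 < q := by linarith
  have hα := alphaVal_pos hq1 hℓ hℓk hk
  have ha : Continuous (aVal q n k ℓ) := by unfold aVal; fun_prop
  have hb : Continuous (bVal q n k ℓ) := by unfold bVal; fun_prop
  have hF : ∀ᶠ lam in 𝓝 (0 : ℝ), ∀ i ∈ Set.Iic ℓ,
      0 ≤ alphaVal q n k ℓ - lam * disjEigenvalue q n ℓ ℓ i := by
    refine (Set.finite_Iic ℓ).eventually_all.2 fun i _ => ?_
    have hc : Continuous fun lam => alphaVal q n k ℓ - lam * disjEigenvalue q n ℓ ℓ i := by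
      fun_prop
    filter_upwards [hc.tendsto 0 |>.eventually_const_lt (u := 0) (by simpa using hα)] with lam h
      using h.le
  have hE : ∀ᶠ lam in 𝓝 (0 : ℝ), ∀ i ∈ Set.Iic k, 1 ≤ i →
      0 ≤ alphaVal q n k ℓ - aVal q n k ℓ lam * disjEigenvalue q n k k i := by
    refine (Set.finite_Iic k).eventually_all.2 fun i hik => ?_
    by_cases hi : 1 ≤ i
    · have hc : Continuous fun lam =>
          alphaVal q n k ℓ - aVal q n k ℓ lam * disjEigenvalue q n k k i := by fun_prop
      have h0 := (abs_le.1 (aVal_zero_mul_le_half hq hℓ hℓk hk hi hik)).2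
      filter_upwards [hc.tendsto 0 |>.eventually_const_lt (u := 0) (by linarith)] with lam h _
        using h.le
    · exact Eventually.of_forall fun lam h => absurd h hi
  have hEF : ∀ᶠ lam in 𝓝 (0 : ℝ), ∀ i ∈ Set.Iic ℓ, 2 ≤ i →
      (bVal q n k ℓ lam * disjEigenvalue q n k ℓ i) ^ 2
        * (disjEigenvalue q n ℓ k i / disjEigenvalue q n k ℓ i)
        ≤ (alphaVal q n k ℓ - aVal q n k ℓ lam * disjEigenvalue q n k k i)
          * (alphaVal q n k ℓ - lam * disjEigenvalue q n ℓ ℓ i) := by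
    refine (Set.finite_Iic ℓ).eventually_all.2 fun i hiℓ => ?_
    by_cases hi : 2 ≤ i
    · have hc1 : Continuous fun lam => (bVal q n k ℓ lam * disjEigenvalue q n k ℓ i) ^ 2
          * (disjEigenvalue q n ℓ k i / disjEigenvalue q n k ℓ i) := by fun_prop
      have hc2 : Continuous fun lam =>
          (alphaVal q n k ℓ - aVal q n k ℓ lam * disjEigenvalue q n k k i)
          * (alphaVal q n k ℓ - lam * disjEigenvalue q n ℓ ℓ i) := by fun_prop
      filter_upwards [(hc1.tendsto 0).eventually_lt (hc2.tendsto 0)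
        (block_pos_of_two_le hq hℓ hℓk hk hi hiℓ)] with lam h _ using h.le
    · exact Eventually.of_forall fun lam h => absurd h hi
  filter_upwards [hF, hE, hEF] with lam h1 h2 h3
  refine ⟨fun i hi => ?_, h1, fun i hi => ?_⟩
  -- In degree 0 the halving bound is unavailable; E_0 is instead a positive multiple of F_0.
  · rcases Nat.eq_zero_or_pos i with rfl | hi0
    · have hA := aVal_mul hq1 hℓ hℓk hk lam
      have hx := pow_sub_one_pos hq1 (a := k) (by omega)
      have hy := pow_sub_one_pos hq1 (a := ℓ) (by omega)
      have h4 := mul_nonneg hy.le (h1 0 (Nat.zero_le ℓ))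
      refine nonneg_of_mul_nonneg_left (b := q ^ k - 1) (h4.trans_eq ?_) hx
      linear_combination hA
    · exact h2 i hi hi0
  · rcases i with _ | _ | i
    · simpa using (block_zero hq1 hℓ hℓk hk lam).le
    · simpa using (block_one hq1 hℓ hℓk hk lam).le
    · simpa using h3 (i + 2) hi (by omega)

end BlockConditions

/-! ### Feasibility of the family -/

section Feasibility

open scoped Matrix

variable {K V ι : Type*} [Field K] [AddCommGroup V] [Module K V]

theorem slackMatrix_isSymm (sub : ι → Submodule K V) (P Q : Set ι) (α β γ : ℝ)
    {A : Matrix ι ι ℝ} (hA : A.IsSymm) : (slackMatrix sub P Q α β γ A).IsSymm := by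
  rw [Matrix.IsSymm, slackMatrix]
  simp only [Matrix.transpose_sub, Matrix.transpose_add, Matrix.transpose_smul,
    inclMatrix_transpose, onesMatrix_transpose, disjMatrix_transpose, hA.eq]
  rw [add_comm (onesMatrix Q P), add_comm (disjMatrix sub Q P)]

variable [Finite K] [FiniteDimensional K V]

theorem familyFeasible_of_blocks [Finite ι] {sub : ι → Submodule K V} {P Q : Set ι} {k ℓ : ℕ}
    (hℓ : 1 ≤ ℓ) (hℓk : ℓ ≤ k) (hk : 2 * k ≤ finrank K V) (hP : ∀ p ∈ P, finrank K (sub p) = k)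
    (hQ : ∀ p ∈ Q, finrank K (sub p) = ℓ) {lam : ℝ} (hlam : 0 < lam)
    (hE : ∀ i ≤ k, 0 ≤ alphaVal (Nat.card K) (finrank K V) k ℓ
      - aVal (Nat.card K) (finrank K V) k ℓ lam
        * disjEigenvalue (Nat.card K) (finrank K V) k k i)
    (hF : ∀ i ≤ ℓ, 0 ≤ alphaVal (Nat.card K) (finrank K V) k ℓ
      - lam * disjEigenvalue (Nat.card K) (finrank K V) ℓ ℓ i)
    (hEF : ∀ i ≤ ℓ, (1 / 2 * (if i = 0 then gauss (Nat.card K) (finrank K V) ℓ else 0)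
        + bVal (Nat.card K) (finrank K V) k ℓ lam
          * disjEigenvalue (Nat.card K) (finrank K V) k ℓ i) ^ 2
      * (disjEigenvalue (Nat.card K) (finrank K V) ℓ k i
        / disjEigenvalue (Nat.card K) (finrank K V) k ℓ i)
      ≤ (alphaVal (Nat.card K) (finrank K V) k ℓ
          - aVal (Nat.card K) (finrank K V) k ℓ lam
            * disjEigenvalue (Nat.card K) (finrank K V) k k i)
        * (alphaVal (Nat.card K) (finrank K V) k ℓ
          - lam * disjEigenvalue (Nat.card K) (finrank K V) ℓ ℓ i)) :
    FamilyFeasible sub P Q k ℓ lam := by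
  have : Finite V := Module.finite_of_finite K
  have : Fintype (Submodule K V) := Fintype.ofFinite _
  have : Fintype ι := Fintype.ofFinite _
  have hq : (1 : ℝ) < Nat.card K := by exact_mod_cast Finite.one_lt_card
  have hsymm : (aVal (Nat.card K) (finrank K V) k ℓ lam • disjMatrix sub P P
      + lam • disjMatrix sub Q Q).IsSymm := by
    rw [Matrix.IsSymm, Matrix.transpose_add, Matrix.transpose_smul, Matrix.transpose_smul,
      disjMatrix_transpose, disjMatrix_transpose]
  refine ⟨hsymm, Matrix.PosSemidef.of_dotProduct_mulVec_nonneg ?_ fun x => ?_, fun x y => ?_⟩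
  · rw [Matrix.IsHermitian, Matrix.conjTranspose_eq_transpose_of_trivial]
    exact slackMatrix_isSymm sub P Q _ _ _ hsymm
  · rw [star_trivial, dotProduct_slackMatrix_mulVec hP hQ]
    exact slack_form_nonneg hℓk hk hE hF hEF (layerPush_eq_zero hP x) (layerPush_eq_zero hQ x)
  · have h1 := aVal_nonneg hq hℓ hℓk hk hlam.le
    have h2 : ∀ R : Set ι, 0 ≤ disjMatrix sub R R x y := fun R => by
      rw [disjMatrix, Matrix.of_apply]
      split_ifs <;> simp
    exact add_nonneg (mul_nonneg h1 (h2 P)) (mul_nonneg hlam.le (h2 Q))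

end Feasibility

theorem theorem2 {K V : Type*} [Field K] [Finite K] [AddCommGroup V] [Module K V]
    [FiniteDimensional K V] (k ℓ : ℕ) (hℓ : 1 ≤ ℓ) (hℓk : ℓ ≤ k) (hk : 2 * k ≤ finrank K V) :
    ∃ ε : ℝ, 0 < ε ∧ ∀ lam : ℝ, 0 < lam → lam < ε →
      (ℓ < k →
        FamilyFeasible (id : Submodule K V → Submodule K V)
          (grass K V k) (grass K V ℓ) k ℓ lam) ∧
      (k = ℓ →
        FamilyFeasible
          (Sum.elim id Subtype.val : Submodule K V ⊕ grass K V ℓ → Submodule K V)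
          (Sum.inl '' grass K V k) (Set.range Sum.inr) k ℓ lam) := by
  have : Finite V := Module.finite_of_finite K
  have hq : (2 : ℝ) ≤ Nat.card K := by exact_mod_cast Finite.one_lt_card
  -- The block conditions involve only `q`, `n`, `k` and `ℓ`, so one ε serves both index sets.
  obtain ⟨ε, hε, hball⟩ := Metric.eventually_nhds_iff.1 (eventually_blocks hq hℓ hℓk hk)
  refine ⟨ε, hε, fun lam hlam hlt => ?_⟩
  obtain ⟨hE, hF, hEF⟩ := hball (y := lam) (by
    rwa [Real.dist_eq, sub_zero, abs_of_pos hlam])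
  refine ⟨fun _ => ?_, fun _ => ?_⟩
  · exact familyFeasible_of_blocks hℓ hℓk hk (fun _ hp => hp) (fun _ hp => hp) hlam hE hF hEF
  · refine familyFeasible_of_blocks hℓ hℓk hk ?_ ?_ hlam hE hF hEF
    · rintro _ ⟨x, hx, rfl⟩
      exact hx
    · rintro _ ⟨x, rfl⟩
      exact x.2
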